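/- Consider a single bosonic mode with Fock basis $\{|n\rangle\}_{n\ge 0}$, annihilation operator $a$, number operator $\hat n=a^\dagger a$, and displacement operators $D(\xi)=e^{\xi a^\dagger-\bar\xi a}$, $\xi\in\mathbb C$. A density operator $\rho$ is called Gaussian with displacement vector $d\in\mathbb R^2$ and covariance matrix $V\in\mathbb R^{2\times 2}$ ($V=V^T$) if $$\mathrm{Tr}[\rho D(\xi)]=\exp\!\left(-\tfrac12 u^TVu+i\sqrt2\,u^Td\right),\qquad u=(\operatorname{Im}\xi,-\operatorname{Re}\xi)^T,\quad \text{for all }\xi\in\mathbb C,$$ so that the vacuum has $d=0$, $V=I$. For $f\ge 0$ and a positive operator $\rho$ write $\mathrm{Tr}[\rho f(\hat n)]=\sum_n f(n)\langle n|\rho|n\rangle\in[0,\infty]$. (1) Let $\alpha\in\mathbb C$, $m\ge 0$, $r\ge 0$, $\omega>0$, and let $\rho$ be Gaussian with $d=\sqrt2(\operatorname{Re}\alpha,\operatorname{Im}\alpha)$ and $V=\mathrm{diag}\big(e^{2r}(2m+1),e^{-2r}(2m+1)\big)$. If $\coth(\omega/2)>(2m+1)e^{2r}$, then $\kappa_\pm=\sqrt{\coth(\omega/2)-(2m+1)e^{\pm2r}}$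 are both well defined and positive, and $$\mathrm{Tr}[\rho e^{\omega\hat n}]=\frac{2\exp\!\left[\frac{2\operatorname{Re}(\alpha)^2}{\kappa_+^2}+\frac{2\operatorname{Im}(\alpha)^2}{\kappa_-^2}\right]}{(e^\omega-1)\,\kappa_+\kappa_-}.$$ If $\coth(\omega/2)\le(2m+1)e^{2r}$, then $\mathrm{Tr}[\rho e^{\omega\hat n}]=+\infty$. (2) Let $\bar n>0$, $0<\epsilon<1$, $\Omega>\frac1{1-\epsilon}$ and $$\omega=\min\left\{\frac{2\epsilon}{\frac32+2\bar n(2+\bar n)},\ \frac{1-\epsilon}{\bar n}\ln\big((1-\epsilon)\Omega\big)\right\}.$$ Then $\omega>0$, and $\mathrm{Tr}[\rho e^{\omega\hat n}]\le\Omega$ for every Gaussian state $\rho$ (with arbitrary $d$ and $V$) such that $\mathrm{Tr}[\rho\hat n]\le\bar n$, and for every $\rho$ in the convex hull of the set of these states. -/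

import Mathlib

noncomputable section

namespace Bosonic

open scoped ComplexConjugate Nat

/-- The Hilbert space of one bosonic mode, written in the Fock basis: `ℓ²(ℕ, ℂ)`. -/
abbrev FockSpace : Type := lp (fun _ : ℕ => ℂ) 2

/-- The Fock (number) state `|n⟩`. -/
def fock (n : ℕ) : FockSpace := lp.single 2 n (1 : ℂ)

/-- The trace `∑ₙ ⟨n| T |n⟩`, an absolutely convergent series when `T` is trace class. -/
def opTrace (T : FockSpace →L[ℂ] FockSpace) : ℂ :=
  ∑' n : ℕ, inner ℂ (fock n) (T (fock n))

/-- Quantum states: positive operators of trace one. -/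
def IsDensityOperator (ρ : FockSpace →L[ℂ] FockSpace) : Prop :=
  ρ.IsPositive ∧ HasSum (fun n : ℕ => inner ℂ (fock n) (ρ (fock n))) 1

/-- `Tr[ρ f(n̂)] = ∑ₙ f(n) ⟨n|ρ|n⟩ ∈ [0, ∞]`, for a nonnegative function `f` of the number operator
`n̂ = ∑ₙ n |n⟩⟨n|` and a positive operator `ρ`. -/
def numberExpectation (ρ : FockSpace →L[ℂ] FockSpace) (f : ℕ → ℝ) : ENNReal :=
  ∑' n : ℕ, ENNReal.ofReal (f n) * ENNReal.ofReal (inner ℂ (fock n) (ρ (fock n))).re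

/-! ### Displacement operators -/

/-- The creation operator `a†` on coefficient sequences: `a† |k⟩ = √(k+1) |k+1⟩`. -/
def creation (x : ℕ → ℂ) : ℕ → ℂ
  | 0 => 0
  | k + 1 => (√((k : ℝ) + 1) : ℂ) * x k

/-- The annihilation operator `a` on coefficient sequences: `a |k+1⟩ = √(k+1) |k⟩`. -/
def annihilation (x : ℕ → ℂ) (k : ℕ) : ℂ := (√((k : ℝ) + 1) : ℂ) * x (k + 1)

/-- Fock coefficients of the coherent state `|ξ⟩ = e^{-|ξ|²/2} ∑ₖ ξᵏ/√(k!) |k⟩`. -/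
def coherentSeq (ξ : ℂ) (k : ℕ) : ℂ :=
  (Real.exp (-‖ξ‖ ^ 2 / 2) : ℂ) * (ξ ^ k / (√(k ! : ℝ) : ℂ))

/-- Fock coefficients of the displaced number state
`D(ξ)|n⟩ = (n!)^{-1/2} (a† - ξ̄)ⁿ |ξ⟩`; indeed `D(ξ) = exp(ξ a† - ξ̄ a)` satisfies `D(ξ)|0⟩ = |ξ⟩`
and `D(ξ) a† D(ξ)† = a† - ξ̄`, while `|n⟩ = (n!)^{-1/2} (a†)ⁿ |0⟩`. -/
def displacedSeq (ξ : ℂ) : ℕ → ℕ → ℂ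
  | 0 => coherentSeq ξ
  | n + 1 => fun k =>
      (creation (displacedSeq ξ n) k - conj ξ * displacedSeq ξ n k) / (√((n : ℝ) + 1) : ℂ)

/-- Auxiliary decay property: `∑ₖ Cᵏ |xₖ|² < ∞` for every `C ≥ 0`. -/
def GeomDecay (x : ℕ → ℂ) : Prop := ∀ C : ℝ, 0 ≤ C → Summable fun k => C ^ k * ‖x k‖ ^ 2

theorem norm_coherentSeq_sq (ξ : ℂ) (k : ℕ) :
    ‖coherentSeq ξ k‖ ^ 2 = Real.exp (-‖ξ‖ ^ 2) * ((‖ξ‖ ^ 2) ^ k / k !) := by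
  have h : (0 : ℝ) ≤ (k ! : ℝ) := by positivity
  have h2 : Real.exp (-‖ξ‖ ^ 2 / 2) ^ 2 = Real.exp (-‖ξ‖ ^ 2) := by
    rw [← Real.exp_nat_mul]; congr 1; push_cast; ring
  rw [coherentSeq, norm_mul, norm_div, norm_pow, Complex.norm_real, Complex.norm_real,
    Real.norm_of_nonneg (Real.exp_pos _).le, Real.norm_of_nonneg (Real.sqrt_nonneg _), mul_pow,
    div_pow, Real.sq_sqrt h, h2]
  ring

theorem geomDecay_coherentSeq (ξ : ℂ) : GeomDecay (coherentSeq ξ) := by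
  intro C _
  have h := (Real.summable_pow_div_factorial (C * ‖ξ‖ ^ 2)).mul_left (Real.exp (-‖ξ‖ ^ 2))
  refine h.congr fun k => ?_
  rw [norm_coherentSeq_sq, mul_pow]; ring

theorem geomDecay_creation {x : ℕ → ℂ} (hx : GeomDecay x) : GeomDecay (creation x) := by
  intro C hC
  rw [← summable_nat_add_iff 1]
  refine Summable.of_nonneg_of_le (fun k => by positivity) (fun k => ?_)
    ((hx (2 * C) (by positivity)).mul_left C)
  have h2 : ((k : ℝ) + 1) ≤ 2 ^ k := by exact_mod_cast Nat.succ_le_of_lt k.lt_two_pow_self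
  have h3 : ‖creation x (k + 1)‖ ^ 2 = ((k : ℝ) + 1) * ‖x k‖ ^ 2 := by
    rw [creation, norm_mul, Complex.norm_real, Real.norm_of_nonneg (Real.sqrt_nonneg _), mul_pow,
      Real.sq_sqrt (by positivity)]
  rw [h3]
  calc C ^ (k + 1) * (((k : ℝ) + 1) * ‖x k‖ ^ 2)
      ≤ C ^ (k + 1) * (2 ^ k * ‖x k‖ ^ 2) := by gcongr
    _ = C * ((2 * C) ^ k * ‖x k‖ ^ 2) := by rw [mul_pow]; ring

theorem geomDecay_displacedSeq (ξ : ℂ) (n : ℕ) : GeomDecay (displacedSeq ξ n) := by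
  induction n with
  | zero => exact geomDecay_coherentSeq ξ
  | succ n ih =>
    intro C hC
    have h1 := ((geomDecay_creation ih) C hC).mul_left 2
    have h2 := (ih C hC).mul_left (2 * ‖ξ‖ ^ 2)
    refine Summable.of_nonneg_of_le (fun k => by positivity) (fun k => ?_) (h1.add h2)
    have hs : (1 : ℝ) ≤ √((n : ℝ) + 1) := by
      rw [Real.one_le_sqrt]; linarith [(Nat.cast_nonneg n : (0 : ℝ) ≤ n)]
    have h3 : ‖displacedSeq ξ (n + 1) k‖
        ≤ ‖creation (displacedSeq ξ n) k‖ + ‖ξ‖ * ‖displacedSeq ξ n k‖ := by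
      rw [displacedSeq, norm_div, Complex.norm_real, Real.norm_of_nonneg (Real.sqrt_nonneg _)]
      refine (div_le_self (norm_nonneg _) hs).trans ((norm_sub_le _ _).trans ?_)
      rw [norm_mul, RCLike.norm_conj]
    have h4 : ‖displacedSeq ξ (n + 1) k‖ ^ 2
        ≤ 2 * ‖creation (displacedSeq ξ n) k‖ ^ 2 + 2 * (‖ξ‖ * ‖displacedSeq ξ n k‖) ^ 2 := by
      have := pow_le_pow_left₀ (norm_nonneg _) h3 2
      nlinarith [sq_nonneg (‖creation (displacedSeq ξ n) k‖ - ‖ξ‖ * ‖displacedSeq ξ n k‖)]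
    calc C ^ k * ‖displacedSeq ξ (n + 1) k‖ ^ 2
        ≤ C ^ k * (2 * ‖creation (displacedSeq ξ n) k‖ ^ 2
            + 2 * (‖ξ‖ * ‖displacedSeq ξ n k‖) ^ 2) := by gcongr
      _ = _ := by ring

theorem memℓp_of_geomDecay {x : ℕ → ℂ} (hx : GeomDecay x) : Memℓp x 2 := by
  refine memℓp_gen ?_
  simpa using hx 1 zero_le_one

/-- The displaced number state `D(ξ)|n⟩`. -/
def displacedFock (ξ : ℂ) (n : ℕ) : FockSpace :=
  ⟨displacedSeq ξ n, memℓp_of_geomDecay (geomDecay_displacedSeq ξ n)⟩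

theorem annihilation_creation (x : ℕ → ℂ) (k : ℕ) :
    annihilation (creation x) k = creation (annihilation x) k + x k := by
  have h (j : ℕ) : ((√((j : ℝ) + 1) : ℝ) : ℂ) * (√((j : ℝ) + 1) : ℝ) = (j : ℂ) + 1 := by
    rw [← Complex.ofReal_mul, Real.mul_self_sqrt (by positivity)]; push_cast; rfl
  cases k with
  | zero => simp [annihilation, creation]
  | succ k =>
    simp only [annihilation, creation]
    rw [← mul_assoc, ← mul_assoc, h, h]; push_cast; ring

theorem annihilation_coherentSeq (ξ : ℂ) (k : ℕ) :
    annihilation (coherentSeq ξ) k = ξ * coherentSeq ξ k := by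
  have h0 : ((√(k ! : ℝ) : ℝ) : ℂ) ≠ 0 := by
    rw [Complex.ofReal_ne_zero]; positivity
  have h1 : ((√((k : ℝ) + 1) : ℝ) : ℂ) ≠ 0 := by
    rw [Complex.ofReal_ne_zero]; positivity
  have h2 : ((√((k + 1) ! : ℝ) : ℝ) : ℂ) = (√((k : ℝ) + 1) : ℝ) * (√(k ! : ℝ) : ℝ) := by
    rw [← Complex.ofReal_mul, ← Real.sqrt_mul (by positivity), Nat.factorial_succ]
    push_cast; rfl
  rw [annihilation, coherentSeq, coherentSeq, h2]
  field_simp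
  ring

theorem annihilation_displacedSeq_zero (ξ : ℂ) (k : ℕ) :
    annihilation (displacedSeq ξ 0) k = ξ * displacedSeq ξ 0 k :=
  annihilation_coherentSeq ξ k

theorem annihilation_displacedSeq_succ (ξ : ℂ) (n k : ℕ) :
    annihilation (displacedSeq ξ (n + 1)) k
      = ξ * displacedSeq ξ (n + 1) k + (√((n : ℝ) + 1) : ℂ) * displacedSeq ξ n k := by
  have hne (j : ℕ) : ((√((j : ℝ) + 1) : ℝ) : ℂ) ≠ 0 := by
    rw [Complex.ofReal_ne_zero]; positivity
  have hsq (j : ℕ) : ((√((j : ℝ) + 1) : ℝ) : ℂ) ^ 2 = (j : ℂ) + 1 := by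
    rw [← Complex.ofReal_pow, Real.sq_sqrt (by positivity)]; push_cast; rfl
  have key (m j : ℕ) : annihilation (displacedSeq ξ (m + 1)) j = (annihilation
      (creation (displacedSeq ξ m)) j - conj ξ * annihilation (displacedSeq ξ m) j)
        / (√((m : ℝ) + 1) : ℂ) := by
    simp only [annihilation, displacedSeq]; ring
  induction n generalizing k with
  | zero =>
    have hc : creation (annihilation (displacedSeq ξ 0)) k
        = ξ * creation (displacedSeq ξ 0) k := by
      cases k with
      | zero => simp [creation]
      | succ k => simp only [creation]; rw [annihilation_displacedSeq_zero]; ring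
    rw [key, annihilation_creation, hc, annihilation_displacedSeq_zero]
    have h1 := hne 0
    have h2 := hsq 0
    rw [show displacedSeq ξ (0 + 1) k = (creation (displacedSeq ξ 0) k
      - conj ξ * displacedSeq ξ 0 k) / (√(((0 : ℕ) : ℝ) + 1) : ℂ) from rfl]
    field_simp
    rw [h2]; push_cast; ring
  | succ n ih =>
    have hc : creation (annihilation (displacedSeq ξ (n + 1))) k
        = ξ * creation (displacedSeq ξ (n + 1)) k
          + (√((n : ℝ) + 1) : ℂ) * creation (displacedSeq ξ n) k := by
      cases k with
      | zero => simp [creation]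
      | succ k => simp only [creation]; rw [ih]; ring
    have hd : (√((n : ℝ) + 1) : ℂ) * displacedSeq ξ (n + 1) k
        = creation (displacedSeq ξ n) k - conj ξ * displacedSeq ξ n k := by
      rw [displacedSeq]; field_simp [hne n]
    rw [key, annihilation_creation, hc, ih]
    have h1 := hne (n + 1)
    have h2 := hsq (n + 1)
    have h3 := hsq n
    rw [show displacedSeq ξ (n + 1 + 1) k = (creation (displacedSeq ξ (n + 1)) k
      - conj ξ * displacedSeq ξ (n + 1) k) / (√(((n + 1 : ℕ) : ℝ) + 1) : ℂ) from rfl]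
    field_simp
    push_cast at h2 h3 ⊢
    rw [h2]
    linear_combination (-(√((n : ℝ) + 1) : ℂ)) * hd + displacedSeq ξ (n + 1) k * h3

/-- `⟨x, (a† - ξ̄) y⟩ = ⟨(a - ξ) x, y⟩` for displaced number states. -/
theorem inner_displacedFock_succ (ξ : ℂ) (m n : ℕ) :
    (√((n : ℝ) + 1) : ℂ) * inner ℂ (displacedFock ξ m) (displacedFock ξ (n + 1))
      = ∑' k, displacedSeq ξ n k
          * conj (annihilation (displacedSeq ξ m) k - ξ * displacedSeq ξ m k) := by
  have hne : ((√((n : ℝ) + 1) : ℝ) : ℂ) ≠ 0 := by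
    rw [Complex.ofReal_ne_zero]; positivity
  have hS1 : Summable fun k => creation (displacedSeq ξ n) k * conj (displacedSeq ξ m k) :=
    lp.summable_inner (𝕜 := ℂ) (displacedFock ξ m)
      (⟨_, memℓp_of_geomDecay (geomDecay_creation (geomDecay_displacedSeq ξ n))⟩ : FockSpace)
  have hS2 : Summable fun k => displacedSeq ξ n k * conj (displacedSeq ξ m k) :=
    lp.summable_inner (𝕜 := ℂ) (displacedFock ξ m) (displacedFock ξ n)
  have hS1' := (summable_nat_add_iff 1).2 hS1
  have hshift : ∑' k, creation (displacedSeq ξ n) k * conj (displacedSeq ξ m k)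
      = ∑' k, creation (displacedSeq ξ n) (k + 1) * conj (displacedSeq ξ m (k + 1)) := by
    rw [hS1.tsum_eq_zero_add]; simp [creation]
  have hL : (√((n : ℝ) + 1) : ℂ) * inner ℂ (displacedFock ξ m) (displacedFock ξ (n + 1))
      = ∑' k, (creation (displacedSeq ξ n) k * conj (displacedSeq ξ m k)
          - conj ξ * (displacedSeq ξ n k * conj (displacedSeq ξ m k))) := by
    rw [lp.inner_eq_tsum, ← tsum_mul_left]
    refine tsum_congr fun k => ?_
    change _ * (displacedSeq ξ (n + 1) k * conj (displacedSeq ξ m k)) = _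
    rw [displacedSeq]; field_simp
  rw [hL, hS1.tsum_sub (hS2.mul_left _), hshift, ← hS1'.tsum_sub (hS2.mul_left _)]
  refine tsum_congr fun k => ?_
  simp only [creation, annihilation, map_sub, map_mul, Complex.conj_ofReal]
  ring

theorem inner_displacedFock_zero_zero (ξ : ℂ) :
    inner ℂ (displacedFock ξ 0) (displacedFock ξ 0) = (1 : ℂ) := by
  rw [lp.inner_eq_tsum]
  have h : ∀ k, inner ℂ (displacedFock ξ 0 k) (displacedFock ξ 0 k)
      = ((Real.exp (-‖ξ‖ ^ 2) * ((‖ξ‖ ^ 2) ^ k / k !) : ℝ) : ℂ) := by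
    intro k
    rw [← norm_coherentSeq_sq, inner_self_eq_norm_sq_to_K]
    simp [displacedFock, displacedSeq]
  have hexp : ∑' k : ℕ, (‖ξ‖ ^ 2) ^ k / (k ! : ℝ) = Real.exp (‖ξ‖ ^ 2) := by
    rw [Real.exp_eq_exp_ℝ]; exact (congrFun NormedSpace.exp_eq_tsum_div _).symm
  rw [tsum_congr h, ← Complex.ofReal_tsum, tsum_mul_left, hexp, ← Real.exp_add]
  simp

theorem inner_displacedFock (ξ : ℂ) (m n : ℕ) :
    inner ℂ (displacedFock ξ m) (displacedFock ξ n) = if m = n then (1 : ℂ) else 0 := by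
  have hne (j : ℕ) : ((√((j : ℝ) + 1) : ℝ) : ℂ) ≠ 0 := by
    rw [Complex.ofReal_ne_zero]; positivity
  have h0 (j : ℕ) : inner ℂ (displacedFock ξ 0) (displacedFock ξ (j + 1)) = (0 : ℂ) := by
    have h := inner_displacedFock_succ ξ 0 j
    simp only [annihilation_displacedSeq_zero, sub_self, map_zero, mul_zero, tsum_zero] at h
    exact (mul_eq_zero.1 h).resolve_left (hne j)
  induction n generalizing m with
  | zero =>
    cases m with
    | zero => exact (inner_displacedFock_zero_zero ξ).trans (if_pos rfl).symm
    | succ m => rw [← inner_conj_symm, h0]; simp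
  | succ n ih =>
    cases m with
    | zero => simpa using h0 n
    | succ m =>
      have h := inner_displacedFock_succ ξ (m + 1) n
      have h' : ∑' k, displacedSeq ξ n k * conj (annihilation (displacedSeq ξ (m + 1)) k
          - ξ * displacedSeq ξ (m + 1) k)
          = (√((m : ℝ) + 1) : ℂ) * inner ℂ (displacedFock ξ m) (displacedFock ξ n) := by
        rw [lp.inner_eq_tsum, ← tsum_mul_left]
        refine tsum_congr fun k => ?_
        change _ = _ * (displacedSeq ξ n k * conj (displacedSeq ξ m k))
        rw [annihilation_displacedSeq_succ, add_sub_cancel_left, map_mul, Complex.conj_ofReal]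
        ring
      rw [h', ih] at h
      by_cases hmn : m = n
      · subst hmn
        rw [if_pos rfl] at h ⊢
        exact mul_left_cancel₀ (hne m) h
      · rw [if_neg hmn, mul_zero] at h
        rw [if_neg (by simpa using hmn)]
        exact (mul_eq_zero.1 h).resolve_left (hne n)

theorem orthonormal_displacedFock (ξ : ℂ) : Orthonormal ℂ (displacedFock ξ) :=
  orthonormal_iff_ite.2 (inner_displacedFock ξ)

/-- The displacement (Weyl) operator `D(ξ) = exp(ξ a† - ξ̄ a)`: the isometry of the Fock space that
sends `|n⟩` to `displacedFock ξ n`. -/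
def displacement (ξ : ℂ) : FockSpace →L[ℂ] FockSpace :=
  (orthonormal_displacedFock ξ).orthogonalFamily.linearIsometry.toContinuousLinearMap

theorem displacement_fock (ξ : ℂ) (n : ℕ) : displacement ξ (fock n) = displacedFock ξ n := by
  have h := (orthonormal_displacedFock ξ).orthogonalFamily.linearIsometry_apply_single
    (i := n) (1 : ℂ)
  rw [LinearIsometry.toSpanSingleton_apply, one_smul] at h
  exact h

/-! ### Gaussian states -/

/-- The characteristic function `χ(ξ) = Tr[ρ D(ξ)]`. -/
def charFunction (ρ : FockSpace →L[ℂ] FockSpace) (ξ : ℂ) : ℂ := opTrace (ρ ∘L displacement ξ)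

/-- `ρ` is the Gaussian state with displacement vector `d` and covariance matrix `V`.

With `x̂ = (a + a†)/√2`, `p̂ = (a - a†)/(i√2)` and `u = (Im ξ, -Re ξ)` one has
`D(ξ) = exp(i √2 (u₀ x̂ + u₁ p̂))`; the normalisation is `d = (⟨x̂⟩, ⟨p̂⟩)` and `V` equal to twice the
symmetrised covariances, so that the vacuum has `d = 0` and `V = 1`. -/
def IsGaussianWith (ρ : FockSpace →L[ℂ] FockSpace) (d : Fin 2 → ℝ)
    (V : Matrix (Fin 2) (Fin 2) ℝ) : Prop :=
  IsDensityOperator ρ ∧ V.IsSymm ∧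
    ∀ ξ : ℂ, charFunction ρ ξ =
      Complex.exp (-(1 / 2 : ℂ) * ((![ξ.im, -ξ.re] ⬝ᵥ V.mulVec ![ξ.im, -ξ.re] : ℝ) : ℂ)
        + Complex.I * ((√2 * (![ξ.im, -ξ.re] ⬝ᵥ d) : ℝ) : ℂ))

/-- Gaussian states: states with a Gaussian characteristic function. -/
def IsGaussian (ρ : FockSpace →L[ℂ] FockSpace) : Prop :=
  ∃ (d : Fin 2 → ℝ) (V : Matrix (Fin 2) (Fin 2) ℝ), IsGaussianWith ρ d V

/-- Gaussian states with mean photon number `Tr[ρ n̂]` at most `nbar`. -/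
def boundedGaussians (nbar : ℝ) : Set (FockSpace →L[ℂ] FockSpace) :=
  {ρ | IsGaussian ρ ∧ numberExpectation ρ (fun n => (n : ℝ)) ≤ ENNReal.ofReal nbar}

/-- The radicand `coth(ω/2) - (2m+1) e^{2s}` of `κ₊²` (for `s = r`) and `κ₋²` (for `s = -r`). -/
def kappaSq (ω m s : ℝ) : ℝ :=
  Real.cosh (ω / 2) / Real.sinh (ω / 2) - (2 * m + 1) * Real.exp (2 * s)

/-- `κ₊` for `s = r`, and `κ₋` for `s = -r`. -/
def kappa (ω m s : ℝ) : ℝ := √(kappaSq ω m s)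

end Bosonic

end

noncomputable section

namespace Bosonic

open scoped ComplexConjugate Nat
open MeasureTheory Filter Topology

/-! ### Traces against isometries -/

/-! Averaging D(ξ) over phase space with the weight exp(-(s - 1/2)‖ξ‖²) gives an operator that is
diagonal in the Fock basis, with eigenvalues (π/s)zⁿ for z = 1 - 1/s. Hence the generating function
Σ pₙ zⁿ of pₙ = ⟨n|ρ|n⟩ is a Gaussian average of the characteristic function (`hasSum_generating`).
For a Gaussian state, rotated so that V = diag(v₁, v₂), this is an elementary integral, and for 0 <
z < 1 it equals G = `gaussGen`.

The value needed is at z = e^ω > 1, where s = 1/(1 - z) is negative and the integral is lost. But G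
is holomorphic up to the nearest zero of its factors 1 + v - z(v - 1), and its Taylor coefficients
at 0 are the pₙ, so the series converges to G on that whole disc (`hasSum_gaussGen`).

Positivity of the pₙ does the rest. It gives |G(z)| ≤ G(|z|), so G cannot blow up on the negative
axis while staying bounded on the positive one; this is the uncertainty relation v₁v₂ ≥ 1
(`one_le_mul_of_hasDiagonalForm`). For v₂ ≤ v₁ and v₁ > 1 the nearest zero is then (v₁ + 1)/(v₁ -
1), and at z = e^ω the factors are (e^ω - 1)(coth(ω/2) - v). So the closed form holds when coth(ω/2)
> v₁; otherwise G blows up below e^ω or at it, and the sum is infinite.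

For the cut-off, G'(1) is at most the mean photon number (`energy_le`), which together with v₁v₂ ≥ 1
bounds v₁ (`eigenvalue_le`). The first term of the minimum defining ω keeps the factors away from
zero, the second controls the displacement exponent. Mixtures follow by convexity of sublevel sets.
-/

theorem orthonormal_fock : Orthonormal ℂ fock := by
  rw [orthonormal_iff_ite]
  intro i j
  rw [fock, lp.inner_single_left]
  by_cases h : i = j
  · subst h; simp [fock]
  · simp [fock, h]

theorem inner_fock (n : ℕ) (x : FockSpace) : inner ℂ (fock n) x = x n := by
  rw [fock, lp.inner_single_left]; simp

theorem tsum_enorm_sq (x : FockSpace) :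
    ∑' n, ENNReal.ofReal (‖inner ℂ (fock n) x‖ ^ 2) = ENNReal.ofReal (‖x‖ ^ 2) := by
  have h := lp.hasSum_norm (p := 2) (by simp) x
  simp only [ENNReal.toReal_ofNat, Real.rpow_ofNat] at h
  rw [← ENNReal.ofReal_tsum_of_nonneg (fun n => by positivity)]
  · simp only [inner_fock, h.tsum_eq]
  · simpa only [inner_fock] using h.summable

theorem tsum_inner_sq_le {v : ℕ → FockSpace} (hv : Orthonormal ℂ v) (x : FockSpace) :
    ∑' n, ENNReal.ofReal (‖inner ℂ (v n) x‖ ^ 2) ≤ ENNReal.ofReal (‖x‖ ^ 2) := by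
  rw [← ENNReal.ofReal_tsum_of_nonneg (fun n => by positivity) (hv.inner_products_summable x)]
  exact ENNReal.ofReal_le_ofReal (hv.tsum_inner_products_le x)

/-- The Hilbert–Schmidt norm does not increase when the Fock basis is replaced by an orthonormal
family. -/
theorem tsum_norm_sq_orthonormal_le {v : ℕ → FockSpace} (hv : Orthonormal ℂ v)
    (S : FockSpace →L[ℂ] FockSpace) :
    ∑' n, ENNReal.ofReal (‖S (v n)‖ ^ 2) ≤ ∑' n, ENNReal.ofReal (‖S (fock n)‖ ^ 2) := by
  have key (w : ℕ → FockSpace) : ∑' n, ENNReal.ofReal (‖S (w n)‖ ^ 2)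
      = ∑' m, ∑' n, ENNReal.ofReal (‖inner ℂ (w n) (S.adjoint (fock m))‖ ^ 2) := by
    rw [ENNReal.tsum_comm]
    refine tsum_congr fun n => ?_
    rw [← tsum_enorm_sq]
    refine tsum_congr fun m => ?_
    rw [ContinuousLinearMap.adjoint_inner_right, norm_inner_symm]
  -- After exchanging the sums, Parseval evaluates the Fock side and Bessel bounds the other,
  -- separately for each m.
  rw [key v, key fock]
  refine ENNReal.tsum_le_tsum fun m => ?_
  rw [tsum_enorm_sq]
  exact tsum_inner_sq_le hv _

theorem exists_factor {E : Type*} [NormedAddCommGroup E] [InnerProductSpace ℂ E] [CompleteSpace E]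
    {ρ : E →L[ℂ] E} (hρ : ρ.IsPositive) :
    ∃ S : E →L[ℂ] E, ∀ x y, inner ℂ x (ρ y) = inner ℂ (S x) (S y) := by
  obtain ⟨S, hS⟩ := CStarAlgebra.nonneg_iff_eq_star_mul_self.1
    ((ContinuousLinearMap.nonneg_iff_isPositive ρ).2 hρ)
  refine ⟨S, fun x y => ?_⟩
  rw [hS, mul_apply_eq_comp, ContinuousLinearMap.star_eq_adjoint,
    ContinuousLinearMap.adjoint_inner_right]

/-- The photon number distribution `⟨n|ρ|n⟩`. -/
def numberProb (ρ : FockSpace →L[ℂ] FockSpace) (n : ℕ) : ℝ := (inner ℂ (fock n) (ρ (fock n))).re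

theorem numberProb_nonneg {ρ : FockSpace →L[ℂ] FockSpace} (hρ : IsDensityOperator ρ) (n : ℕ) :
    0 ≤ numberProb ρ n := by
  obtain ⟨S, hS⟩ := exists_factor hρ.1
  rw [numberProb, hS]
  exact inner_self_nonneg (𝕜 := ℂ)

theorem hasSum_numberProb {ρ : FockSpace →L[ℂ] FockSpace} (hρ : IsDensityOperator ρ) :
    HasSum (numberProb ρ) 1 := by
  exact Complex.hasSum_re hρ.2

theorem inner_fock_self {ρ : FockSpace →L[ℂ] FockSpace} (hρ : IsDensityOperator ρ) (n : ℕ) :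
    inner ℂ (fock n) (ρ (fock n)) = (numberProb ρ n : ℂ) := by
  obtain ⟨S, hS⟩ := exists_factor hρ.1
  rw [numberProb, hS, inner_self_eq_norm_sq_to_K]
  norm_cast

/-- Factor ρ = S†S and apply Cauchy–Schwarz and AM-GM termwise: both Hilbert–Schmidt sums are at
most Tr ρ = 1. This uniform bound makes the trace series of ρ D(ξ) absolutely convergent, gives |χ|
≤ 1, and dominates the exchange of trace and integral. -/
theorem sum_norm_inner_le {ρ : FockSpace →L[ℂ] FockSpace} (hρ : IsDensityOperator ρ)
    {v : ℕ → FockSpace} (hv : Orthonormal ℂ v) (s : Finset ℕ) :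
    ∑ n ∈ s, ‖inner ℂ (fock n) (ρ (v n))‖ ≤ 1 := by
  obtain ⟨S, hS⟩ := exists_factor hρ.1
  have hfock : ∑' n, ENNReal.ofReal (‖S (fock n)‖ ^ 2) = 1 := by
    have h : ∀ n, ‖S (fock n)‖ ^ 2 = numberProb ρ n := fun n => by
      rw [numberProb, hS, inner_self_eq_norm_sq_to_K]; norm_cast
    simp only [h]
    rw [← ENNReal.ofReal_tsum_of_nonneg (numberProb_nonneg hρ) (hasSum_numberProb hρ).summable,
      (hasSum_numberProb hρ).tsum_eq, ENNReal.ofReal_one]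
  have hsum (w : ℕ → FockSpace) (hw : Orthonormal ℂ w) : ∑ n ∈ s, ‖S (w n)‖ ^ 2 ≤ 1 := by
    have h := (ENNReal.sum_le_tsum s).trans ((tsum_norm_sq_orthonormal_le hw S).trans_eq hfock)
    rw [← ENNReal.ofReal_sum_of_nonneg (fun n _ => by positivity)] at h
    simpa using h
  have h1 := hsum fock orthonormal_fock
  have h2 := hsum v hv
  calc ∑ n ∈ s, ‖inner ℂ (fock n) (ρ (v n))‖
      ≤ ∑ n ∈ s, (‖S (fock n)‖ ^ 2 / 2 + ‖S (v n)‖ ^ 2 / 2) := by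
        refine Finset.sum_le_sum fun n _ => ?_
        rw [hS]
        refine (norm_inner_le_norm _ _).trans ?_
        nlinarith [sq_nonneg (‖S (fock n)‖ - ‖S (v n)‖)]
    _ ≤ 1 := by
        rw [Finset.sum_add_distrib, ← Finset.sum_div, ← Finset.sum_div]; linarith

theorem charFunction_eq_tsum (ρ : FockSpace →L[ℂ] FockSpace) (ξ : ℂ) :
    charFunction ρ ξ = ∑' n, inner ℂ (fock n) (ρ (displacedFock ξ n)) := by
  simp only [charFunction, opTrace, ContinuousLinearMap.comp_apply, displacement_fock]

theorem norm_charFunction_le {ρ : FockSpace →L[ℂ] FockSpace} (hρ : IsDensityOperator ρ) (ξ : ℂ) :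
    ‖charFunction ρ ξ‖ ≤ 1 := by
  have hb := sum_norm_inner_le hρ (orthonormal_displacedFock ξ)
  have hs := summable_of_sum_le (fun n => norm_nonneg _) hb
  rw [charFunction_eq_tsum]
  exact (norm_tsum_le_tsum_norm hs).trans (hs.tsum_le_of_sum_le hb)

/-- Termwise integration of a series whose finite partial sums of norms are dominated. -/
theorem hasSum_integral_of_sum_norm_le {α : Type*} [MeasurableSpace α] {μ : Measure α}
    {F : ℕ → α → ℂ} {g : α → ℝ} (hF : ∀ n, AEStronglyMeasurable (F n) μ) (hg : Integrable g μ)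
    (h : ∀ (s : Finset ℕ) a, ∑ n ∈ s, ‖F n a‖ ≤ g a) :
    HasSum (fun n => ∫ a, F n a ∂μ) (∫ a, ∑' n, F n a ∂μ) := by
  have hi : ∀ n, Integrable (F n) μ := fun n =>
    hg.mono' (hF n) (ae_of_all _ fun a => by simpa using h {n} a)
  refine hasSum_integral_of_summable_integral_norm hi
    (summable_of_sum_le (c := ∫ a, g a ∂μ) (fun n => integral_nonneg fun a => norm_nonneg _) ?_)
  intro s
  rw [← integral_finsetSum _ fun n _ => (hi n).norm]
  exact integral_mono (integrable_finsetSum _ fun n _ => (hi n).norm) hg (h s)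

theorem norm_displacedFock (ξ : ℂ) (n : ℕ) : ‖displacedFock ξ n‖ = 1 :=
  (orthonormal_displacedFock ξ).1 n

theorem continuous_displacedSeq (n k : ℕ) : Continuous fun ξ => displacedSeq ξ n k := by
  induction n generalizing k with
  | zero =>
    simp only [displacedSeq, coherentSeq]
    fun_prop
  | succ n ih =>
    have hc : Continuous fun ξ => creation (displacedSeq ξ n) k := by
      cases k with
      | zero => exact continuous_const
      | succ k => exact continuous_const.mul (ih k)
    simp only [displacedSeq]
    exact (hc.sub (Complex.continuous_conj.mul (ih k))).div_const _

theorem inner_displacedFock_eq_tsum (x : FockSpace) (ξ : ℂ) (n : ℕ) :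
    inner ℂ x (displacedFock ξ n) = ∑' k, conj (x k) * displacedSeq ξ n k := by
  rw [lp.inner_eq_tsum]
  refine tsum_congr fun k => ?_
  rw [RCLike.inner_apply, mul_comm]; rfl

theorem sum_norm_mul_displacedSeq_le (x : FockSpace) (ξ : ℂ) (n : ℕ) (s : Finset ℕ) :
    ∑ k ∈ s, ‖conj (x k) * displacedSeq ξ n k‖ ≤ ‖x‖ ^ 2 / 2 + 1 / 2 := by
  have hs (y : FockSpace) : ∑ k ∈ s, ‖y k‖ ^ 2 ≤ ‖y‖ ^ 2 := by
    have h := lp.hasSum_norm (p := 2) (by simp) y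
    simp only [ENNReal.toReal_ofNat, Real.rpow_ofNat] at h
    exact sum_le_hasSum s (fun k _ => by positivity) h
  have h1 := hs x
  have h2 : ∑ k ∈ s, ‖displacedSeq ξ n k‖ ^ 2 ≤ 1 := by
    have h := hs (displacedFock ξ n)
    rwa [norm_displacedFock, one_pow] at h
  calc ∑ k ∈ s, ‖conj (x k) * displacedSeq ξ n k‖
      ≤ ∑ k ∈ s, (‖x k‖ ^ 2 / 2 + ‖displacedSeq ξ n k‖ ^ 2 / 2) := by
        refine Finset.sum_le_sum fun k _ => ?_
        rw [norm_mul, RCLike.norm_conj]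
        nlinarith [sq_nonneg (‖x k‖ - ‖displacedSeq ξ n k‖)]
    _ ≤ _ := by
        rw [Finset.sum_add_distrib, ← Finset.sum_div, ← Finset.sum_div]; linarith

theorem measurable_inner_displacedFock (x : FockSpace) (n : ℕ) :
    Measurable fun ξ => inner ℂ x (displacedFock ξ n) := by
  simp only [inner_displacedFock_eq_tsum]
  exact Measurable.tsum fun k => ((continuous_displacedSeq n k).const_mul _).measurable

/-! ### Gaussian averages of the matrix elements of displacement operators -/

/-- The creation operator as a linear endomorphism of coefficient sequences. -/
def creationLin : Module.End ℂ (ℕ → ℂ) where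
  toFun := creation
  map_add' x y := by
    funext k; cases k <;> simp [creation, mul_add]
  map_smul' c x := by
    funext k; cases k <;> simp [creation]; ring

/-- For j > k the truncated exponent k - j is harmless, since the descending factorial vanishes. -/
theorem creationLin_pow_coherentSeq (ξ : ℂ) (j k : ℕ) :
    (creationLin ^ j) (coherentSeq ξ) k
      = (Real.exp (-‖ξ‖ ^ 2 / 2) : ℂ) * (ξ ^ (k - j) * k.descFactorial j / (√(k ! : ℝ) : ℂ)) := by
  induction j generalizing k with
  | zero => simp [coherentSeq]
  | succ j ih =>
    rw [pow_succ', Module.End.mul_apply]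
    cases k with
    | zero => simp [creationLin, creation]
    | succ k =>
      have h0 : ((√(k ! : ℝ) : ℝ) : ℂ) ≠ 0 := by
        rw [Complex.ofReal_ne_zero]; positivity
      have h1 : ((√((k : ℝ) + 1) : ℝ) : ℂ) ≠ 0 := by
        rw [Complex.ofReal_ne_zero]; positivity
      have h2 : ((√((k + 1) ! : ℝ) : ℝ) : ℂ) = (√((k : ℝ) + 1) : ℝ) * (√(k ! : ℝ) : ℝ) := by
        rw [← Complex.ofReal_mul, ← Real.sqrt_mul (by positivity), Nat.factorial_succ]
        push_cast; rfl
      have h3 : ((√((k : ℝ) + 1) : ℝ) : ℂ) ^ 2 = (k : ℂ) + 1 := by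
        rw [← Complex.ofReal_pow, Real.sq_sqrt (by positivity)]; push_cast; rfl
      change (√((k : ℝ) + 1) : ℂ) * (creationLin ^ j) (coherentSeq ξ) k = _
      rw [ih, h2, Nat.succ_descFactorial_succ, Nat.add_sub_add_right]
      field_simp
      rw [h3]; push_cast; ring

theorem displacedSeq_eq_pow (ξ : ℂ) (n : ℕ) :
    displacedSeq ξ n = (√(n ! : ℝ) : ℂ)⁻¹ •
      ((creationLin + algebraMap ℂ (Module.End ℂ (ℕ → ℂ)) (-conj ξ)) ^ n) (coherentSeq ξ) := by
  induction n with
  | zero => simp [displacedSeq]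
  | succ n ih =>
    have h2 : ((√((n + 1) ! : ℝ) : ℝ) : ℂ) = (√((n : ℝ) + 1) : ℝ) * (√(n ! : ℝ) : ℝ) := by
      rw [← Complex.ofReal_mul, ← Real.sqrt_mul (by positivity), Nat.factorial_succ]
      push_cast; rfl
    have h3 : displacedSeq ξ (n + 1) = (√((n : ℝ) + 1) : ℂ)⁻¹ •
        ((creationLin + algebraMap ℂ (Module.End ℂ (ℕ → ℂ)) (-conj ξ)) (displacedSeq ξ n)) := by
      funext k
      simp [displacedSeq, creationLin, Module.algebraMap_end_apply]
      ring
    rw [h3, ih, pow_succ', Module.End.mul_apply, map_smul, smul_smul, h2, mul_inv]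

/-- Closed form of the matrix elements `⟨k|D(ξ)|n⟩`. -/
theorem displacedSeq_eq_sum (ξ : ℂ) (n k : ℕ) :
    displacedSeq ξ n k = ∑ j ∈ Finset.range (n + 1),
      ((-1) ^ (n - j) * n.choose j * k.descFactorial j / (√(n ! : ℝ) * √(k ! : ℝ) : ℂ))
        * (ξ ^ (k - j) * conj ξ ^ (n - j) * (Real.exp (-‖ξ‖ ^ 2 / 2) : ℂ)) := by
  rw [displacedSeq_eq_pow, (show Commute creationLin (algebraMap ℂ (Module.End ℂ (ℕ → ℂ)) (-conj ξ)) from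
    (Algebra.commutes _ _).symm).add_pow]
  simp only [Pi.smul_apply, LinearMap.sum_apply, Finset.sum_apply, smul_eq_mul, Finset.mul_sum]
  refine Finset.sum_congr rfl fun j _ => ?_
  rw [← map_pow, ← map_natCast (algebraMap ℂ (Module.End ℂ (ℕ → ℂ))), mul_assoc, ← map_mul,
    Module.End.mul_apply, Module.algebraMap_end_apply, map_smul, Pi.smul_apply,
    creationLin_pow_coherentSeq, smul_eq_mul, neg_pow]
  field_simp

theorem integral_norm_pow_mul_exp (a : ℕ) {s : ℝ} (hs : 0 < s) :
    ∫ ξ : ℂ, ‖ξ‖ ^ (2 * a) * Real.exp (-s * ‖ξ‖ ^ 2) = Real.pi * a ! / s ^ (a + 1) := by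
  have h := Complex.integral_rpow_mul_exp_neg_mul_rpow (p := 2) (q := ((2 * a : ℕ) : ℝ)) (b := s)
    one_le_two (by linarith [(Nat.cast_nonneg (2 * a) : (0 : ℝ) ≤ ((2 * a : ℕ) : ℝ))]) hs
  simp only [Real.rpow_natCast, Real.rpow_two] at h
  rw [h]
  have h1 : -(((2 * a : ℕ) : ℝ) + 2) / 2 = -((a + 1 : ℕ) : ℝ) := by push_cast; ring
  have h2 : (((2 * a : ℕ) : ℝ) + 2) / 2 = (a : ℝ) + 1 := by push_cast; ring
  rw [h1, h2, Real.Gamma_nat_eq_factorial, Real.rpow_neg hs.le, Real.rpow_natCast]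
  field_simp

/-- The integral of a non-integrable function is 0 by convention, so the nonzero closed form already
implies integrability. -/
theorem integrable_norm_pow_mul_exp (p : ℕ) {s : ℝ} (hs : 0 < s) :
    Integrable fun ξ : ℂ => ‖ξ‖ ^ p * Real.exp (-s * ‖ξ‖ ^ 2) := by
  have h := Complex.integral_rpow_mul_exp_neg_mul_rpow (p := 2) (q := (p : ℝ)) (b := s)
    one_le_two (by linarith [(Nat.cast_nonneg p : (0 : ℝ) ≤ (p : ℝ))]) hs
  simp only [Real.rpow_natCast, Real.rpow_two] at h
  by_contra hn
  rw [integral_undef hn] at h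
  have h1 : 0 < Real.Gamma ((p + 2 : ℝ) / 2) := Real.Gamma_pos_of_pos (by positivity)
  have h2 : 0 < s ^ (-(p + 2 : ℝ) / 2) := Real.rpow_pos_of_pos hs _
  have h3 := Real.pi_pos
  have h4 : 0 < 2 * Real.pi / 2 * s ^ (-(p + 2 : ℝ) / 2) * Real.Gamma ((p + 2 : ℝ) / 2) := by
    positivity
  exact h4.ne h

theorem integral_comp_unit_mul {u : ℂ} (hu : ‖u‖ = 1) (f : ℂ → ℂ) :
    ∫ ξ, f (u * ξ) = ∫ ξ, f ξ := by
  let c : Circle := ⟨u, mem_sphere_zero_iff_norm.2 hu⟩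
  exact ((rotation c).measurePreserving).integral_comp
    (rotation c).toHomeomorph.measurableEmbedding f

theorem integrable_moment (a b : ℕ) {s : ℝ} (hs : 0 < s) :
    Integrable fun ξ : ℂ => ξ ^ a * conj ξ ^ b * (Real.exp (-s * ‖ξ‖ ^ 2) : ℂ) := by
  refine (integrable_norm_pow_mul_exp (a + b) hs).mono'
    (Continuous.aestronglyMeasurable (by fun_prop)) (ae_of_all _ fun ξ => le_of_eq ?_)
  rw [norm_mul, norm_mul, norm_pow, norm_pow, RCLike.norm_conj, Complex.norm_real,
    Real.norm_of_nonneg (Real.exp_pos _).le, pow_add]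

theorem integral_moment (a b : ℕ) {s : ℝ} (hs : 0 < s) :
    ∫ ξ : ℂ, ξ ^ a * conj ξ ^ b * (Real.exp (-s * ‖ξ‖ ^ 2) : ℂ)
      = if a = b then (Real.pi * a ! / s ^ (a + 1) : ℂ) else 0 := by
  split_ifs with hab
  · subst hab
    have h : ∀ ξ : ℂ, ξ ^ a * conj ξ ^ a * (Real.exp (-s * ‖ξ‖ ^ 2) : ℂ)
        = ((‖ξ‖ ^ (2 * a) * Real.exp (-s * ‖ξ‖ ^ 2) : ℝ) : ℂ) := fun ξ => by
      rw [← mul_pow, Complex.mul_conj']; push_cast; ring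
    simp only [h]
    rw [integral_complex_ofReal, integral_norm_pow_mul_exp a hs]
    push_cast; rfl
  · have hexp (θ : ℝ) : ‖Complex.exp (θ * Complex.I)‖ = 1 := Complex.norm_exp_ofReal_mul_I θ
    have hne : ((a : ℝ) - b) ≠ 0 := sub_ne_zero.2 (by exact_mod_cast hab)
    -- Rotation by θ multiplies the integrand by e^{iθ(a - b)} = -1 and preserves the integral,
    -- which is therefore 0.
    set θ : ℝ := Real.pi / ((a : ℝ) - b) with hθ
    set u : ℂ := Complex.exp (θ * Complex.I) with hu
    have hconj : conj u = Complex.exp (-(θ * Complex.I)) := by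
      rw [hu, ← Complex.exp_conj]; simp
    have hu1 : u ^ a * conj u ^ b = -1 := by
      rw [hconj, hu, ← Complex.exp_nat_mul, ← Complex.exp_nat_mul, ← Complex.exp_add,
        ← Complex.exp_pi_mul_I]
      congr 1
      have : (θ : ℂ) * ((a : ℂ) - b) = Real.pi := by
        rw [hθ]; push_cast
        exact div_mul_cancel₀ _ (by exact_mod_cast hne)
      linear_combination Complex.I * this
    have h := integral_comp_unit_mul (hexp θ)
      (fun ξ => ξ ^ a * conj ξ ^ b * (Real.exp (-s * ‖ξ‖ ^ 2) : ℂ))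
    have h' : ∀ ξ : ℂ, (u * ξ) ^ a * conj (u * ξ) ^ b * (Real.exp (-s * ‖u * ξ‖ ^ 2) : ℂ)
        = -(ξ ^ a * conj ξ ^ b * (Real.exp (-s * ‖ξ‖ ^ 2) : ℂ)) := fun ξ => by
      rw [norm_mul, hexp, one_mul, map_mul, mul_pow, mul_pow]
      linear_combination (ξ ^ a * conj ξ ^ b * (Real.exp (-s * ‖ξ‖ ^ 2) : ℂ)) * hu1
    rw [← hu] at h
    simp only [h', integral_neg] at h
    exact self_eq_neg.1 h.symm

/-- The coherent-state factor exp(-‖ξ‖²/2) completes the weight to exp(-s‖ξ‖²). Rotation invariance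
kills the off-diagonal elements, and on the diagonal the radial moments add up to the binomial
expansion of (1 - 1/s)ⁿ. -/
theorem integral_weight_displacedSeq {s : ℝ} (hs : 0 < s) (n k : ℕ) :
    ∫ ξ : ℂ, (Real.exp (-(s - 1 / 2) * ‖ξ‖ ^ 2) : ℂ) * displacedSeq ξ n k
      = if k = n then (Real.pi / s * (1 - 1 / s) ^ n : ℂ) else 0 := by
  have hexp (ξ : ℂ) : Real.exp (-(s - 1 / 2) * ‖ξ‖ ^ 2) * Real.exp (-‖ξ‖ ^ 2 / 2)
      = Real.exp (-s * ‖ξ‖ ^ 2) := by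
    rw [← Real.exp_add]; congr 1; ring
  have hterm : ∀ ξ : ℂ, (Real.exp (-(s - 1 / 2) * ‖ξ‖ ^ 2) : ℂ) * displacedSeq ξ n k
      = ∑ j ∈ Finset.range (n + 1),
      ((-1) ^ (n - j) * n.choose j * k.descFactorial j / (√(n ! : ℝ) * √(k ! : ℝ) : ℂ))
        * (ξ ^ (k - j) * conj ξ ^ (n - j) * (Real.exp (-s * ‖ξ‖ ^ 2) : ℂ)) := fun ξ => by
    rw [displacedSeq_eq_sum, Finset.mul_sum]
    refine Finset.sum_congr rfl fun j _ => ?_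
    rw [← hexp, Complex.ofReal_mul]; ring
  simp only [hterm]
  rw [integral_finsetSum _ fun j _ => (integrable_moment _ _ hs).const_mul _]
  simp only [integral_const_mul, integral_moment _ _ hs]
  have hsc : (s : ℂ) ≠ 0 := by exact_mod_cast hs.ne'
  split_ifs with hkn
  · subst hkn
    have hk : ((√(k ! : ℝ) : ℝ) : ℂ) * (√(k ! : ℝ) : ℝ) = (k ! : ℂ) := by
      rw [← Complex.ofReal_mul, Real.mul_self_sqrt (by positivity)]; push_cast; rfl
    rw [hk, show (1 - 1 / s : ℂ) = 1 + (-1 / s) by ring, add_pow, Finset.mul_sum]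
    refine Finset.sum_congr rfl fun j hj => ?_
    have hjk : j ≤ k := Nat.lt_succ_iff.1 (Finset.mem_range.1 hj)
    have hd : ((k - j)! : ℂ) * (k.descFactorial j : ℂ) = k ! := by
      exact_mod_cast Nat.factorial_mul_descFactorial hjk
    have hk0 : (k ! : ℂ) ≠ 0 := by exact_mod_cast k.factorial_ne_zero
    rw [if_pos rfl, div_pow, one_pow, one_mul, pow_succ]
    field_simp
    linear_combination (k.choose j : ℂ) * hd
  · refine Finset.sum_eq_zero fun j hj => ?_
    have hjn : j ≤ n := Nat.lt_succ_iff.1 (Finset.mem_range.1 hj)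
    rcases lt_or_ge k j with hlt | hge
    · simp [Nat.descFactorial_of_lt hlt]
    · rw [if_neg (by omega), mul_zero]

/-! ### The generating function of the photon number distribution -/

theorem integral_weight_inner {ρ : FockSpace →L[ℂ] FockSpace} (hρ : IsDensityOperator ρ) {s : ℝ}
    (hs : 1 / 2 < s) (n : ℕ) :
    ∫ ξ : ℂ, (Real.exp (-(s - 1 / 2) * ‖ξ‖ ^ 2) : ℂ)
        * inner ℂ (fock n) (ρ (displacedFock ξ n))
      = (Real.pi / s : ℂ) * (numberProb ρ n * (1 - 1 / s : ℂ) ^ n) := by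
  have hsymm (ξ : ℂ) : inner ℂ (fock n) (ρ (displacedFock ξ n))
      = inner ℂ (ρ (fock n)) (displacedFock ξ n) :=
    (hρ.1.isSymmetric (fock n) (displacedFock ξ n)).symm
  -- With ρ moved to the fixed vector |n⟩, the integrand is a series in the matrix elements
  -- ⟨k|D(ξ)|n⟩, of which only k = n survives integration.
  simp only [hsymm, inner_displacedFock_eq_tsum, ← tsum_mul_left]
  have hw : Integrable fun ξ : ℂ => Real.exp (-(s - 1 / 2) * ‖ξ‖ ^ 2) := by
    simpa using integrable_norm_pow_mul_exp 0 (s := s - 1 / 2) (by linarith)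
  have h := hasSum_integral_of_sum_norm_le (μ := (volume : Measure ℂ))
    (F := fun k ξ => (Real.exp (-(s - 1 / 2) * ‖ξ‖ ^ 2) : ℂ)
      * (conj (ρ (fock n) k) * displacedSeq ξ n k))
    (g := fun ξ => Real.exp (-(s - 1 / 2) * ‖ξ‖ ^ 2) * (‖ρ (fock n)‖ ^ 2 / 2 + 1 / 2))
    (fun k => Continuous.aestronglyMeasurable (Continuous.mul (by fun_prop)
      (continuous_const.mul (continuous_displacedSeq n k))))
    (hw.mul_const _) (fun t ξ => by
      simp only [norm_mul (Complex.ofReal _), ← Finset.mul_sum, Complex.norm_real,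
        Real.norm_of_nonneg (Real.exp_pos _).le]
      gcongr
      exact sum_norm_mul_displacedSeq_le _ ξ n t)
  rw [← h.tsum_eq]
  have hk (k : ℕ) : ∫ ξ : ℂ, (Real.exp (-(s - 1 / 2) * ‖ξ‖ ^ 2) : ℂ)
      * (conj (ρ (fock n) k) * displacedSeq ξ n k)
      = if k = n then (Real.pi / s : ℂ) * (numberProb ρ n * (1 - 1 / s : ℂ) ^ n) else 0 := by
    simp only [mul_left_comm _ (conj (ρ (fock n) k))]
    rw [integral_const_mul, integral_weight_displacedSeq (by linarith)]
    split_ifs with hkn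
    · subst hkn
      have hp : ρ (fock k) k = (numberProb ρ k : ℂ) := by rw [← inner_fock, inner_fock_self hρ]
      rw [hp, Complex.conj_ofReal]; ring
    · exact mul_zero _
  simp only [hk, tsum_ite_eq]

/-- The number generating function as a Gaussian average of the characteristic function. -/
theorem hasSum_generating {ρ : FockSpace →L[ℂ] FockSpace} (hρ : IsDensityOperator ρ) {s : ℝ}
    (hs : 1 / 2 < s) :
    HasSum (fun n => (numberProb ρ n : ℂ) * (1 - 1 / s : ℂ) ^ n)
      ((s / Real.pi : ℂ) * ∫ ξ : ℂ, (Real.exp (-(s - 1 / 2) * ‖ξ‖ ^ 2) : ℂ) * charFunction ρ ξ) := by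
  have hw : Integrable fun ξ : ℂ => Real.exp (-(s - 1 / 2) * ‖ξ‖ ^ 2) := by
    simpa using integrable_norm_pow_mul_exp 0 (s := s - 1 / 2) (by linarith)
  have hsymm (n : ℕ) (ξ : ℂ) : inner ℂ (fock n) (ρ (displacedFock ξ n))
      = inner ℂ (ρ (fock n)) (displacedFock ξ n) :=
    (hρ.1.isSymmetric (fock n) (displacedFock ξ n)).symm
  have h := hasSum_integral_of_sum_norm_le (μ := (volume : Measure ℂ))
    (F := fun n ξ => (Real.exp (-(s - 1 / 2) * ‖ξ‖ ^ 2) : ℂ)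
      * inner ℂ (fock n) (ρ (displacedFock ξ n)))
    (g := fun ξ => Real.exp (-(s - 1 / 2) * ‖ξ‖ ^ 2))
    (fun n => by
      simp only [hsymm]
      exact (Measurable.mul (Continuous.measurable (by fun_prop))
        (measurable_inner_displacedFock _ n)).aestronglyMeasurable)
    hw (fun t ξ => by
      simp only [norm_mul, ← Finset.mul_sum, Complex.norm_real,
        Real.norm_of_nonneg (Real.exp_pos _).le]
      exact mul_le_of_le_one_right (Real.exp_pos _).le
        (sum_norm_inner_le hρ (orthonormal_displacedFock ξ) t))
  simp only [tsum_mul_left, ← charFunction_eq_tsum, integral_weight_inner hρ hs] at h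
  have hsc : (s : ℂ) ≠ 0 := by
    rw [Complex.ofReal_ne_zero]; linarith
  have hpi : (Real.pi : ℂ) ≠ 0 := by exact_mod_cast Real.pi_ne_zero
  refine (h.mul_left (s / Real.pi : ℂ)).congr_fun fun n => ?_
  field_simp

/-! ### Gaussian integrals and the closed form on (0, 1) -/

theorem integral_gaussian_fourier {b : ℝ} (hb : 0 < b) (t : ℝ) :
    ∫ x : ℝ, Complex.exp (((-b * x ^ 2 : ℝ) : ℂ) + Complex.I * ((t * x : ℝ) : ℂ))
      = ((√(Real.pi / b) * Real.exp (-t ^ 2 / (4 * b)) : ℝ) : ℂ) := by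
  have h := fourierIntegral_gaussian (b := (b : ℂ)) (by simpa using hb) (t : ℂ)
  have h2 : ((Real.pi : ℂ) / b) ^ (1 / 2 : ℂ) = ((√(Real.pi / b) : ℝ) : ℂ) := by
    rw [Real.sqrt_eq_rpow, Complex.ofReal_cpow (div_nonneg Real.pi_pos.le hb.le)]
    push_cast; rfl
  rw [h2] at h
  push_cast
  rw [← h]
  refine integral_congr_ae (ae_of_all _ fun x => ?_)
  simp only [← Complex.exp_add]
  congr 1; ring

/-- Up to a rotation of phase space, `ρ` has a Gaussian characteristic function with displacement
`(e₁, e₂)` and covariance matrix `diag(v₁, v₂)`. -/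
def HasDiagonalForm (ρ : FockSpace →L[ℂ] FockSpace) (v₁ v₂ e₁ e₂ : ℝ) : Prop :=
  ∃ u : ℂ, ‖u‖ = 1 ∧ ∀ ξ : ℂ, charFunction ρ (u * ξ) =
    Complex.exp (((-(1 / 2) * (v₁ * ξ.im ^ 2 + v₂ * ξ.re ^ 2) : ℝ) : ℂ)
      + Complex.I * ((√2 * (ξ.im * e₁ - ξ.re * e₂) : ℝ) : ℂ))

/-- The Gaussian number generating function at real arguments. -/
def gaussGen (v₁ v₂ e₁ e₂ z : ℝ) : ℝ :=
  2 / (√(1 + v₁ - z * (v₁ - 1)) * √(1 + v₂ - z * (v₂ - 1)))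
    * Real.exp (-(1 - z) * (e₁ ^ 2 / (1 + v₁ - z * (v₁ - 1)) + e₂ ^ 2 / (1 + v₂ - z * (v₂ - 1))))

theorem integral_weight_diagonal {v₁ v₂ : ℝ} (hv₁ : 0 ≤ v₁) (hv₂ : 0 ≤ v₂) (e₁ e₂ : ℝ) {q : ℝ}
    (hq : 0 < q) :
    ∫ ξ : ℂ, (Real.exp (-q * ‖ξ‖ ^ 2) : ℂ)
        * Complex.exp (((-(1 / 2) * (v₁ * ξ.im ^ 2 + v₂ * ξ.re ^ 2) : ℝ) : ℂ)
          + Complex.I * ((√2 * (ξ.im * e₁ - ξ.re * e₂) : ℝ) : ℂ))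
      = ((√(Real.pi / (q + v₂ / 2)) * Real.exp (-(-√2 * e₂) ^ 2 / (4 * (q + v₂ / 2))) : ℝ) : ℂ)
        * ((√(Real.pi / (q + v₁ / 2)) * Real.exp (-(√2 * e₁) ^ 2 / (4 * (q + v₁ / 2))) : ℝ) : ℂ) := by
  rw [← integral_gaussian_fourier (by positivity), ← integral_gaussian_fourier (by positivity),
    ← integral_prod_mul, ← Measure.volume_eq_prod,
    ← Complex.volume_preserving_equiv_real_prod.integral_comp
      Complex.measurableEquivRealProd.measurableEmbedding]
  refine integral_congr_ae (ae_of_all _ fun ξ => ?_)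
  simp only [Complex.measurableEquivRealProd_apply]
  rw [Complex.ofReal_exp, ← Complex.exp_add, ← Complex.exp_add, Complex.sq_norm,
    Complex.normSq_apply]
  congr 1
  push_cast
  ring

theorem hasSum_gaussGen_of_lt_one {ρ : FockSpace →L[ℂ] FockSpace} (hρ : IsDensityOperator ρ)
    {v₁ v₂ e₁ e₂ : ℝ} (hv₁ : 0 ≤ v₁) (hv₂ : 0 ≤ v₂) (h : HasDiagonalForm ρ v₁ v₂ e₁ e₂) {z : ℝ}
    (hz0 : 0 < z) (hz1 : z < 1) :
    HasSum (fun n => numberProb ρ n * z ^ n) (gaussGen v₁ v₂ e₁ e₂ z) := by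
  obtain ⟨u, hu, hχ⟩ := h
  have h1 : 0 < 1 - z := by linarith
  -- The choice s = 1/(1 - z) solves z = 1 - 1/s.
  have hs : 1 / 2 < 1 / (1 - z) := by
    rw [div_lt_div_iff₀ two_pos h1]; linarith
  have hF := hasSum_generating hρ hs
  -- The weight depends on ‖ξ‖ only, so the diagonalising rotation is absorbed by a change of
  -- variables.
  rw [← integral_comp_unit_mul hu] at hF
  simp only [norm_mul, hu, one_mul, hχ] at hF
  rw [integral_weight_diagonal hv₁ hv₂ e₁ e₂ (by linarith)] at hF
  rw [← Complex.hasSum_ofReal]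
  convert hF using 1
  · funext n
    push_cast
    rw [one_div_one_div, sub_sub_cancel]
  · have ht₁ : 0 < 1 + v₁ - z * (v₁ - 1) := by nlinarith
    have ht₂ : 0 < 1 + v₂ - z * (v₂ - 1) := by nlinarith
    have hb (v : ℝ) : 1 / (1 - z) - 1 / 2 + v / 2 = (1 + v - z * (v - 1)) / (2 * (1 - z)) := by
      field_simp; ring
    have h2 : √(2 : ℝ) ^ 2 = 2 := Real.sq_sqrt zero_le_two
    have hE (e t : ℝ) (ht : 0 < t) : -(2 * e ^ 2) / (4 * (t / (2 * (1 - z))))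
        = -(1 - z) * (e ^ 2 / t) := by
      field_simp; ring
    have hsq (t : ℝ) : √(Real.pi / (t / (2 * (1 - z)))) = √(2 * Real.pi * (1 - z)) / √t := by
      rw [← Real.sqrt_div (by have := Real.pi_pos; positivity)]
      congr 1
      field_simp
    rw [hb, hb, mul_pow, mul_pow, neg_sq, h2, hE _ _ ht₁, hE _ _ ht₂, hsq, hsq, gaussGen, mul_add,
      Real.exp_add]
    norm_cast
    have hpp := Real.mul_self_sqrt (show 0 ≤ 2 * Real.pi * (1 - z) by
      have := Real.pi_pos; positivity)
    have hs₁ := (Real.sqrt_pos.2 ht₁).ne'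
    have hs₂ := (Real.sqrt_pos.2 ht₂).ne'
    have hpi := Real.pi_ne_zero
    set X := √(2 * Real.pi * (1 - z))
    field_simp
    linear_combination (-1 : ℝ) * hpp

/-! ### Analytic continuation -/

/-- A power series that converges on `[0, 1)` and agrees on `(0, 1)` with a function holomorphic on
the disc of radius `r` converges to that function on the whole disc. -/
theorem hasSum_of_eq_on_interval {p : ℕ → ℝ} (hp : Summable p) (hp0 : ∀ n, 0 ≤ p n) {G : ℂ → ℂ}
    {r : ℝ} (hr : 0 < r) (hG : DifferentiableOn ℂ G (Metric.ball 0 r))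
    (heq : ∀ x : ℝ, 0 < x → x < 1 → HasSum (fun n => (p n : ℂ) * (x : ℂ) ^ n) (G x)) {z : ℂ}
    (hz : ‖z‖ < r) : HasSum (fun n => (p n : ℂ) * z ^ n) (G z) := by
  let P : FormalMultilinearSeries ℂ ℂ ℂ := FormalMultilinearSeries.ofScalars ℂ fun n => (p n : ℂ)
  have hPr : (1 : ENNReal) ≤ P.radius := by
    have : ((1 : NNReal) : ENNReal) ≤ P.radius := by
      refine P.le_radius_of_summable_norm ?_
      refine Summable.of_nonneg_of_le (fun n => by positivity) (fun n => ?_) hp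
      simp only [P, NNReal.coe_one, one_pow, mul_one]
      rw [FormalMultilinearSeries.ofScalars_norm, Complex.norm_real, Real.norm_of_nonneg (hp0 n)]
    simpa using this
  have hPF : HasFPowerSeriesAt P.sum P 0 :=
    (P.hasFPowerSeriesOnBall (zero_lt_one.trans_le hPr)).hasFPowerSeriesAt
  have hsum : ∀ x : ℂ, P.sum x = ∑' n, (p n : ℂ) * x ^ n := fun x => by
    simp only [FormalMultilinearSeries.sum, P, FormalMultilinearSeries.ofScalars_apply_eq,
      smul_eq_mul]
  have hGan : AnalyticAt ℂ G 0 := hG.analyticAt (Metric.ball_mem_nhds 0 hr)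
  have hev : P.sum =ᶠ[𝓝 0] G := by
    refine (hPF.analyticAt.frequently_eq_iff_eventually_eq hGan).1 ?_
    -- The points 1/(n + 2) lie in (0, 1) and accumulate at 0, so the identity theorem applies at 0.
    have ht : Tendsto (fun n : ℕ => ((1 / ((n : ℝ) + 1 + 1) : ℝ) : ℂ)) atTop (𝓝[≠] 0) := by
      refine tendsto_nhdsWithin_iff.2 ⟨?_, Eventually.of_forall fun n => ?_⟩
      · have h1 := (tendsto_one_div_add_atTop_nhds_zero_nat (𝕜 := ℝ)).comp (tendsto_add_atTop_nat 1)
        have h2 := (Complex.continuous_ofReal.tendsto 0).comp h1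
        rw [Complex.ofReal_zero] at h2
        refine h2.congr fun n => ?_
        simp
      · simp only [Set.mem_compl_iff, Set.mem_singleton_iff, Complex.ofReal_eq_zero]
        positivity
    refine ht.frequently (Frequently.of_forall fun n => ?_)
    have hn : (0 : ℝ) ≤ n := n.cast_nonneg
    rw [hsum, (heq _ (by positivity) (by rw [div_lt_one (by positivity)]; linarith)).tsum_eq]
  have hPG : HasFPowerSeriesAt G P 0 := hPF.congr hev
  have hT := Complex.hasSum_taylorSeries_on_ball hG (z := z) (by simpa using hz)
  have hcoef : ∀ n : ℕ, ((n ! : ℂ))⁻¹ * iteratedDeriv n G 0 = (p n : ℂ) := fun n => by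
    have hGP := hGan.hasFPowerSeriesAt.eq_formalMultilinearSeries hPG
    have h := congrArg (fun Q : FormalMultilinearSeries ℂ ℂ ℂ => Q.coeff n) hGP
    simp only [FormalMultilinearSeries.coeff_ofScalars, P] at h
    rw [← h]
    field_simp
  refine hT.congr_fun fun n => ?_
  rw [← hcoef, sub_zero, smul_eq_mul, smul_eq_mul]; ring

/-- The Gaussian number generating function at complex arguments. -/
def gaussGenC (v₁ v₂ e₁ e₂ : ℝ) (z : ℂ) : ℂ :=
  2 * ((1 + v₁ - z * (v₁ - 1)) ^ ((-(1 / 2) : ℝ) : ℂ) * (1 + v₂ - z * (v₂ - 1)) ^ ((-(1 / 2) : ℝ) : ℂ))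
    * Complex.exp (-(1 - z) * (e₁ ^ 2 / (1 + v₁ - z * (v₁ - 1)) + e₂ ^ 2 / (1 + v₂ - z * (v₂ - 1))))

theorem cpow_neg_half_ofReal {t : ℝ} (ht : 0 < t) :
    (t : ℂ) ^ ((-(1 / 2) : ℝ) : ℂ) = ((√t)⁻¹ : ℝ) := by
  rw [← Complex.ofReal_cpow ht.le, Real.rpow_neg ht.le, ← Real.sqrt_eq_rpow]

theorem gaussGenC_ofReal {v₁ v₂ z : ℝ} (e₁ e₂ : ℝ) (h₁ : 0 < 1 + v₁ - z * (v₁ - 1))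
    (h₂ : 0 < 1 + v₂ - z * (v₂ - 1)) :
    gaussGenC v₁ v₂ e₁ e₂ z = gaussGen v₁ v₂ e₁ e₂ z := by
  have hc (v : ℝ) : (1 + v - z * (v - 1) : ℂ) = ((1 + v - z * (v - 1) : ℝ) : ℂ) := by
    push_cast; ring
  rw [gaussGenC, hc, hc, cpow_neg_half_ofReal h₁, cpow_neg_half_ofReal h₂, gaussGen]
  push_cast
  rw [div_eq_mul_inv 2 (_ * _), mul_inv]

/-- The hypothesis says r ≤ (v + 1)/|v - 1| with the denominator cleared, which also covers v = 1,
where the factor has no zero. Positive real part keeps each factor in the domain of the principal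
branch of the power. -/
theorem re_pos_of_norm_lt {v r : ℝ} {z : ℂ} (hv : 0 ≤ v) (hr : r * |v - 1| ≤ v + 1) (hz : ‖z‖ < r) :
    0 < (1 + v - z * (v - 1) : ℂ).re := by
  have h1 : (1 + v - z * (v - 1) : ℂ).re = 1 + v - z.re * (v - 1) := by simp
  rw [h1]
  have h2 : z.re * (v - 1) ≤ ‖z‖ * |v - 1| :=
    (le_abs_self _).trans (by rw [abs_mul]; gcongr; exact Complex.abs_re_le_norm z)
  rcases eq_or_lt_of_le (abs_nonneg (v - 1)) with h | h
  · rw [← h] at h2; linarith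
  · nlinarith

theorem differentiableOn_gaussGenC {v₁ v₂ r : ℝ} (e₁ e₂ : ℝ) (hv₁ : 0 ≤ v₁) (hv₂ : 0 ≤ v₂)
    (hr₁ : r * |v₁ - 1| ≤ v₁ + 1) (hr₂ : r * |v₂ - 1| ≤ v₂ + 1) :
    DifferentiableOn ℂ (gaussGenC v₁ v₂ e₁ e₂) (Metric.ball 0 r) := by
  intro z hz
  have hz' : ‖z‖ < r := by simpa using hz
  have h₁ := re_pos_of_norm_lt hv₁ hr₁ hz'
  have h₂ := re_pos_of_norm_lt hv₂ hr₂ hz'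
  have hne {w : ℂ} (h : 0 < w.re) : w ≠ 0 := fun h0 => by simp [h0] at h
  have d (v : ℝ) : DifferentiableAt ℂ (fun z : ℂ => 1 + (v : ℂ) - z * (v - 1)) z := by fun_prop
  have dp {v : ℝ} (h : 0 < (1 + v - z * (v - 1) : ℂ).re) : DifferentiableAt ℂ
      (fun z : ℂ => (1 + (v : ℂ) - z * (v - 1)) ^ ((-(1 / 2) : ℝ) : ℂ)) z :=
    (d v).cpow_const (Complex.mem_slitPlane_iff.2 (Or.inl h))
  have de (e : ℝ) {v : ℝ} (h : 0 < (1 + v - z * (v - 1) : ℂ).re) : DifferentiableAt ℂ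
      (fun z : ℂ => (e : ℂ) ^ 2 / (1 + (v : ℂ) - z * (v - 1))) z :=
    (differentiableAt_const _).div (d v) (hne h)
  refine DifferentiableAt.differentiableWithinAt ?_
  unfold gaussGenC
  exact (((dp h₁).mul (dp h₂)).const_mul 2).mul
    (((differentiableAt_id.const_sub 1).neg.mul ((de e₁ h₁).add (de e₂ h₂))).cexp)

theorem hasSum_gaussGenC {ρ : FockSpace →L[ℂ] FockSpace} (hρ : IsDensityOperator ρ)
    {v₁ v₂ e₁ e₂ r : ℝ} (hv₁ : 0 ≤ v₁) (hv₂ : 0 ≤ v₂) (h : HasDiagonalForm ρ v₁ v₂ e₁ e₂)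
    (hr : 0 < r) (hr₁ : r * |v₁ - 1| ≤ v₁ + 1) (hr₂ : r * |v₂ - 1| ≤ v₂ + 1) {z : ℂ}
    (hz : ‖z‖ < r) :
    HasSum (fun n => (numberProb ρ n : ℂ) * z ^ n) (gaussGenC v₁ v₂ e₁ e₂ z) := by
  refine hasSum_of_eq_on_interval (hasSum_numberProb hρ).summable (numberProb_nonneg hρ) hr
    (differentiableOn_gaussGenC e₁ e₂ hv₁ hv₂ hr₁ hr₂) (fun x hx0 hx1 => ?_) hz
  rw [gaussGenC_ofReal e₁ e₂ (by nlinarith) (by nlinarith)]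
  exact_mod_cast Complex.hasSum_ofReal.2 (hasSum_gaussGen_of_lt_one hρ hv₁ hv₂ h hx0 hx1)

theorem hasSum_gaussGen {ρ : FockSpace →L[ℂ] FockSpace} (hρ : IsDensityOperator ρ)
    {v₁ v₂ e₁ e₂ r : ℝ} (hv₁ : 0 ≤ v₁) (hv₂ : 0 ≤ v₂) (h : HasDiagonalForm ρ v₁ v₂ e₁ e₂)
    (hr₁ : r * |v₁ - 1| ≤ v₁ + 1) (hr₂ : r * |v₂ - 1| ≤ v₂ + 1) {z : ℝ}
    (hz0 : 0 ≤ z) (hz : z < r) :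
    HasSum (fun n => numberProb ρ n * z ^ n) (gaussGen v₁ v₂ e₁ e₂ z) := by
  have hz' : ‖(z : ℂ)‖ < r := by rwa [Complex.norm_real, Real.norm_of_nonneg hz0]
  have h' := hasSum_gaussGenC hρ hv₁ hv₂ h (hz0.trans_lt hz) hr₁ hr₂ hz'
  have t₁ := re_pos_of_norm_lt hv₁ hr₁ hz'
  have t₂ := re_pos_of_norm_lt hv₂ hr₂ hz'
  simp only [Complex.sub_re, Complex.add_re, Complex.one_re, Complex.ofReal_re, Complex.mul_re,
    Complex.ofReal_im, Complex.sub_im, Complex.one_im, mul_zero, sub_zero] at t₁ t₂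
  rw [gaussGenC_ofReal e₁ e₂ t₁ t₂] at h'
  exact_mod_cast h'

/-- A power series with nonnegative coefficients is largest on the positive half-axis. -/
theorem norm_gaussGenC_le {ρ : FockSpace →L[ℂ] FockSpace} (hρ : IsDensityOperator ρ)
    {v₁ v₂ e₁ e₂ r : ℝ} (hv₁ : 0 ≤ v₁) (hv₂ : 0 ≤ v₂) (h : HasDiagonalForm ρ v₁ v₂ e₁ e₂)
    (hr₁ : r * |v₁ - 1| ≤ v₁ + 1) (hr₂ : r * |v₂ - 1| ≤ v₂ + 1) {z : ℂ}
    (hz : ‖z‖ < r) :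
    ‖gaussGenC v₁ v₂ e₁ e₂ z‖ ≤ gaussGen v₁ v₂ e₁ e₂ ‖z‖ := by
  have h1 := hasSum_gaussGenC hρ hv₁ hv₂ h ((norm_nonneg z).trans_lt hz) hr₁ hr₂ hz
  have h2 := hasSum_gaussGen hρ hv₁ hv₂ h hr₁ hr₂ (norm_nonneg z) hz
  rw [← h1.tsum_eq, ← h2.tsum_eq]
  have hn : ∀ n, ‖(numberProb ρ n : ℂ) * z ^ n‖ = numberProb ρ n * ‖z‖ ^ n := fun n => by
    rw [norm_mul, norm_pow, Complex.norm_real, Real.norm_of_nonneg (numberProb_nonneg hρ n)]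
  simp only [← hn] at h2 ⊢
  exact norm_tsum_le_tsum_norm h2.summable

/-! ### The uncertainty relation -/

/-- A negative variance would make |χ| exceed 1 along the corresponding axis. -/
theorem HasDiagonalForm.nonneg {ρ : FockSpace →L[ℂ] FockSpace} (hρ : IsDensityOperator ρ)
    {v₁ v₂ e₁ e₂ : ℝ} (h : HasDiagonalForm ρ v₁ v₂ e₁ e₂) : 0 ≤ v₁ ∧ 0 ≤ v₂ := by
  obtain ⟨u, -, hχ⟩ := h
  have key (ξ : ℂ) : -(1 / 2) * (v₁ * ξ.im ^ 2 + v₂ * ξ.re ^ 2) ≤ 0 := by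
    have h1 := norm_charFunction_le hρ (u * ξ)
    rw [hχ, Complex.norm_exp, Real.exp_le_one_iff] at h1
    simpa only [Complex.add_re, Complex.ofReal_re, Complex.mul_re, Complex.I_re, zero_mul,
      Complex.ofReal_im, mul_zero, sub_zero, add_zero] using h1
  have h1 := key Complex.I
  have h2 := key 1
  simp at h1 h2
  exact ⟨h1, h2⟩

theorem norm_gaussGenC (v₁ v₂ e₁ e₂ : ℝ) (z : ℂ) :
    ‖gaussGenC v₁ v₂ e₁ e₂ z‖
      = 2 * (‖(1 + v₁ - z * (v₁ - 1) : ℂ)‖ ^ (-(1 / 2) : ℝ)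
          * ‖(1 + v₂ - z * (v₂ - 1) : ℂ)‖ ^ (-(1 / 2) : ℝ))
        * Real.exp (-(e₁ ^ 2 * ((1 - z) / (1 + v₁ - z * (v₁ - 1)) : ℂ).re
          + e₂ ^ 2 * ((1 - z) / (1 + v₂ - z * (v₂ - 1)) : ℂ).re)) := by
  rw [gaussGenC, norm_mul, norm_mul, norm_mul, Complex.norm_cpow_real, Complex.norm_cpow_real,
    Complex.norm_exp]
  have h (A B : ℂ) : -(1 - z) * (e₁ ^ 2 / A + e₂ ^ 2 / B)
      = -(((e₁ ^ 2 : ℝ) : ℂ) * ((1 - z) / A) + ((e₂ ^ 2 : ℝ) : ℂ) * ((1 - z) / B)) := by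
    push_cast; ring
  rw [h, Complex.neg_re, Complex.add_re, Complex.re_ofReal_mul, Complex.re_ofReal_mul]
  simp

theorem gaussGen_le {v₁ v₂ e₁ e₂ m r x : ℝ} (hm : 0 < m)
    (h₁ : m ≤ 1 + v₁ - x * (v₁ - 1)) (h₂ : m ≤ 1 + v₂ - x * (v₂ - 1)) (hr : 0 ≤ r)
    (hxr : x ≤ r) :
    gaussGen v₁ v₂ e₁ e₂ x ≤ 2 / m * Real.exp (r * ((e₁ ^ 2 + e₂ ^ 2) / m)) := by
  have hmm : √m * √m = m := Real.mul_self_sqrt hm.le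
  have hS : e₁ ^ 2 / (1 + v₁ - x * (v₁ - 1)) + e₂ ^ 2 / (1 + v₂ - x * (v₂ - 1))
      ≤ (e₁ ^ 2 + e₂ ^ 2) / m := by
    rw [add_div]; gcongr
  have hS0 : 0 ≤ e₁ ^ 2 / (1 + v₁ - x * (v₁ - 1)) + e₂ ^ 2 / (1 + v₂ - x * (v₂ - 1)) :=
    add_nonneg (div_nonneg (sq_nonneg _) (hm.le.trans h₁))
      (div_nonneg (sq_nonneg _) (hm.le.trans h₂))
  rw [gaussGen]
  refine mul_le_mul ?_ (Real.exp_le_exp.2 ?_) (Real.exp_pos _).le (by positivity)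
  · conv_rhs => rw [← hmm]
    gcongr
  · refine (mul_le_mul_of_nonneg_right (by linarith : -(1 - x) ≤ r) hS0).trans ?_
    gcongr

/-- If v₁v₂ < 1, then v₂ < 1 and the second factor vanishes at -r with r = (1 + v₂)/(1 - v₂), while
both factors stay away from zero on [0, r]. Positivity of the coefficients then bounds G on the
disc, yet G should blow up at -r. Along the real axis the displacement exponential could suppress
this blow-up, so -r is approached along a tangent circle on which the exponent stays bounded. -/
theorem one_le_mul_of_hasDiagonalForm {ρ : FockSpace →L[ℂ] FockSpace} (hρ : IsDensityOperator ρ)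
    {v₁ v₂ e₁ e₂ : ℝ} (h : HasDiagonalForm ρ v₁ v₂ e₁ e₂) (hv : v₂ ≤ v₁) : 1 ≤ v₁ * v₂ := by
  by_contra! hlt
  obtain ⟨hv₁, hv₂⟩ := h.nonneg hρ
  have hv₂1 : v₂ < 1 := by nlinarith
  set δ := 1 - v₂ with hδ
  have hδ0 : 0 < δ := by linarith
  set r := (1 + v₂) / δ with hr
  have hr0 : 0 < r := by positivity
  have hrδ : r * δ = 1 + v₂ := div_mul_cancel₀ _ hδ0.ne'
  have hr₂ : r * |v₂ - 1| ≤ v₂ + 1 := by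
    rw [abs_of_neg (by linarith)]; linarith
  have hr₁ : r * |v₁ - 1| ≤ v₁ + 1 := by
    rw [hr, div_mul_eq_mul_div, div_le_iff₀ hδ0]
    rcases abs_cases (v₁ - 1) with ⟨h, _⟩ | ⟨h, _⟩ <;> rw [h] <;> nlinarith
  -- The second entry is 1 + v₁ - r(v₁ - 1), the least value of the first factor on [0, r] when v₁ ≥
  -- 1; a factor with v ≤ 1 is at least 1 there.
  set m := min 1 (2 * (1 - v₁ * v₂) / δ) with hm
  have hm0 : 0 < m := lt_min one_pos (div_pos (by linarith) hδ0)
  set M := 2 / m * Real.exp (r * ((e₁ ^ 2 + e₂ ^ 2) / m)) with hM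
  have hbound : ∀ z : ℂ, ‖z‖ < r → ‖gaussGenC v₁ v₂ e₁ e₂ z‖ ≤ M := by
    intro z hz
    refine (norm_gaussGenC_le hρ hv₁ hv₂ h hr₁ hr₂ hz).trans
      (gaussGen_le hm0 ?_ ?_ hr0.le hz.le)
    · rcases le_total 1 v₁ with h1 | h1
      · refine (min_le_right _ _).trans ?_
        have h2 : ‖z‖ * (v₁ - 1) ≤ r * (v₁ - 1) :=
          mul_le_mul_of_nonneg_right hz.le (by linarith)
        have h3 : 2 * (1 - v₁ * v₂) / δ = 1 + v₁ - r * (v₁ - 1) := by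
          rw [hr]; field_simp; rw [hδ]; ring
        linarith
      · refine (min_le_left _ _).trans ?_
        nlinarith [norm_nonneg z]
    · refine (min_le_left _ _).trans ?_
      nlinarith [norm_nonneg z]
  -- When v₁ = v₂ the second term is 1/0 = 0, and B = 1/δ is still the right bound.
  set B := 1 / δ + 1 / (v₁ - v₂) with hB
  set C := e₁ ^ 2 * B + e₂ ^ 2 * (1 / δ) with hC
  set T := 1 + (v₁ - v₂) * (1 + r) with hT
  have hT0 : 0 < T := by
    have : 0 ≤ (v₁ - v₂) * (1 + r) := mul_nonneg (by linarith) (by linarith)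
    linarith
  have hlow : ∀ N : ℝ, 0 ≤ N →
      2 * (T ^ (-(1 / 2) : ℝ) * N ^ (1 / 2 : ℝ)) * Real.exp (-C) ≤ M := by
    intro N hN
    have hden : (1 + N * Complex.I : ℂ) ≠ 0 := fun h0 => by
      have := congrArg Complex.re h0; simp at this
    have hden2 : (1 + 2 * N * Complex.I : ℂ) ≠ 0 := fun h0 => by
      have := congrArg Complex.re h0; simp at this
    have hδc : (δ : ℂ) ≠ 0 := by exact_mod_cast hδ0.ne'
    have hδc' : (δ : ℂ) = 1 - v₂ := by rw [hδ]; push_cast; rfl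
    -- τ is the prescribed value of the second factor. It runs over the circle ‖τ‖² = Re τ, on which
    -- Re(1/τ) = 1, and tends to 0 as N grows; z is solved from it. Then (1 - z)/τ = (1 + 2Ni)/δ has
    -- constant real part 1/δ.
    set τ : ℂ := (1 + N * Complex.I)⁻¹ with hτ
    set z : ℂ := (τ - (1 + v₂)) / δ with hz
    have hzδ : z * δ = τ - (1 + v₂) := div_mul_cancel₀ _ hδc
    have ht₂ : (1 + v₂ - z * (v₂ - 1) : ℂ) = τ := by
      rw [hδc'] at hzδ; linear_combination hzδ
    have hNsq : Complex.normSq (1 + N * Complex.I) = 1 + N ^ 2 := by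
      rw [Complex.normSq_apply]; simp; ring
    have hτre : τ.re = 1 / (1 + N ^ 2) := by
      rw [hτ, Complex.inv_re, hNsq]; simp
    have hτnorm : ‖τ‖ ^ 2 = 1 / (1 + N ^ 2) := by
      rw [hτ, norm_inv, inv_pow, Complex.sq_norm, hNsq, one_div]
    have hznorm : ‖z‖ < r := by
      rw [hz, norm_div, Complex.norm_real, Real.norm_of_nonneg hδ0.le, hr]
      refine div_lt_div_of_pos_right ?_ hδ0
      refine lt_of_pow_lt_pow_left₀ 2 (by linarith) ?_
      have h1 : ‖τ - (1 + v₂)‖ ^ 2 = ‖τ‖ ^ 2 - 2 * (1 + v₂) * τ.re + (1 + v₂) ^ 2 := by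
        rw [Complex.sq_norm, Complex.sq_norm, Complex.normSq_apply, Complex.normSq_apply]
        simp; ring
      rw [h1, hτnorm, hτre]
      have : 0 < 1 / (1 + N ^ 2) := by positivity
      nlinarith
    have hone : 1 - z = (1 + 2 * N * Complex.I) / (δ * (1 + N * Complex.I)) := by
      rw [eq_div_iff (mul_ne_zero hδc hden)]
      have h1 : τ * (1 + N * Complex.I) = 1 := inv_mul_cancel₀ hden
      linear_combination (-(1 + N * Complex.I)) * hzδ - h1 + (1 + N * Complex.I) * hδc'
    set w : ℂ := δ / (1 + 2 * N * Complex.I) with hw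
    have hone0 : 1 - z ≠ 0 := by
      rw [hone]; exact div_ne_zero hden2 (mul_ne_zero hδc hden)
    have hτw : τ = (1 - z) * w := by
      rw [hone, hw, hτ, div_mul_div_comm, mul_comm (1 + 2 * (N : ℂ) * Complex.I),
        mul_div_mul_right _ _ hden2, div_mul_cancel_left₀ hδc]
    have ht₁ : (1 + v₁ - z * (v₁ - 1) : ℂ) = (1 - z) * ((v₁ - v₂ : ℝ) + w) := by
      push_cast; rw [mul_add, ← hτw, ← ht₂]; ring
    have hwinv : w⁻¹ = ((1 / δ : ℝ) : ℂ) + ((2 * N / δ : ℝ) : ℂ) * Complex.I := by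
      rw [hw, inv_div]; push_cast; ring
    have hwinvre : w⁻¹.re = 1 / δ := by
      rw [hwinv]
      simp only [Complex.add_re, Complex.ofReal_re, Complex.mul_re, Complex.I_re, mul_zero,
        Complex.ofReal_im, Complex.I_im, zero_mul, sub_zero, add_zero]
    have hre₂ : ((1 - z) / (1 + v₂ - z * (v₂ - 1)) : ℂ).re = 1 / δ := by
      rw [ht₂, hτw, div_mul_cancel_left₀ hone0, hwinvre]
    have hre₁ : ((1 - z) / (1 + v₁ - z * (v₁ - 1)) : ℂ).re ≤ B := by
      rw [ht₁, div_mul_cancel_left₀ hone0]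
      rcases hv.eq_or_lt with heq | hlt'
      · rw [hB, heq, sub_self, Complex.ofReal_zero, zero_add, hwinvre]; simp
      · have hwre : 0 ≤ w.re := by
          have h1 : w = (w⁻¹)⁻¹ := (inv_inv w).symm
          rw [h1, Complex.inv_re, hwinvre]
          exact div_nonneg (by positivity) (Complex.normSq_nonneg _)
        have hq : v₁ - v₂ ≤ ‖((v₁ - v₂ : ℝ) : ℂ) + w‖ := by
          refine le_trans ?_ (Complex.re_le_norm _)
          rw [Complex.add_re, Complex.ofReal_re]; linarith
        refine (Complex.re_le_norm _).trans ?_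
        rw [norm_inv, ← one_div]
        have h1 : 0 < v₁ - v₂ := by linarith
        have h2 : 1 / ‖((v₁ - v₂ : ℝ) : ℂ) + w‖ ≤ 1 / (v₁ - v₂) :=
          one_div_le_one_div_of_le h1 hq
        have h3 : 0 < 1 / δ := by positivity
        linarith
    have hT₁ : ‖(1 + v₁ - z * (v₁ - 1) : ℂ)‖ ≤ T := by
      have h1 : (1 + v₁ - z * (v₁ - 1) : ℂ) = τ + ((v₁ - v₂ : ℝ) : ℂ) * (1 - z) := by
        rw [← ht₂]; push_cast; ring
      have h2 : ‖τ‖ ≤ 1 := by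
        refine pow_le_one_iff_of_nonneg (norm_nonneg _) two_ne_zero |>.1 ?_
        rw [hτnorm, div_le_one (by positivity)]; nlinarith
      have h3 : ‖1 - z‖ ≤ 1 + r := (norm_sub_le _ _).trans (by rw [norm_one]; linarith)
      rw [h1]
      refine (norm_add_le _ _).trans (add_le_add h2 ?_)
      rw [norm_mul, Complex.norm_real, Real.norm_of_nonneg (by linarith)]
      exact mul_le_mul_of_nonneg_left h3 (by linarith)
    have ht₁0 : 0 < ‖(1 + v₁ - z * (v₁ - 1) : ℂ)‖ := norm_pos_iff.2 fun h0 => by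
      have := re_pos_of_norm_lt hv₁ hr₁ hznorm
      rw [h0] at this; simp at this
    have hNτ : N ^ (1 / 2 : ℝ) ≤ ‖τ‖ ^ (-(1 / 2) : ℝ) := by
      rw [hτ, norm_inv, Real.inv_rpow (norm_nonneg _), Real.rpow_neg (norm_nonneg _), inv_inv]
      refine Real.rpow_le_rpow hN ?_ (by norm_num)
      refine le_trans ?_ (Complex.im_le_norm _)
      simp
    have hexp : Real.exp (-C) ≤ Real.exp (-(e₁ ^ 2 * ((1 - z) / (1 + v₁ - z * (v₁ - 1)) : ℂ).re
          + e₂ ^ 2 * ((1 - z) / (1 + v₂ - z * (v₂ - 1)) : ℂ).re)) := by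
      rw [Real.exp_le_exp, hre₂, hC]
      have := mul_le_mul_of_nonneg_left hre₁ (sq_nonneg e₁)
      linarith
    refine le_trans ?_ (hbound z hznorm)
    rw [norm_gaussGenC]
    refine mul_le_mul (mul_le_mul_of_nonneg_left (mul_le_mul ?_ ?_ ?_ ?_) two_pos.le) hexp
      (Real.exp_pos _).le (by positivity)
    · exact Real.rpow_le_rpow_of_nonpos ht₁0 hT₁ (by norm_num)
    · rwa [ht₂]
    · positivity
    · positivity
  set A := 2 * T ^ (-(1 / 2) : ℝ) * Real.exp (-C) with hA
  have hA0 : 0 < A := by positivity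
  have hM0 : 0 < M := by positivity
  -- With √N = M/A + 1 the lower bound becomes M + A, which exceeds M.
  have hN := hlow ((M / A + 1) ^ 2) (by positivity)
  rw [← Real.sqrt_eq_rpow, Real.sqrt_sq (by positivity)] at hN
  have : 2 * (T ^ (-(1 / 2) : ℝ) * (M / A + 1)) * Real.exp (-C) = M + A := by
    rw [show 2 * (T ^ (-(1 / 2) : ℝ) * (M / A + 1)) * Real.exp (-C) = A * (M / A + 1) by
      rw [hA]; ring]
    field_simp
  linarith

/-! ### Number expectations of Gaussian states -/

theorem exists_unit_sq_mul_eq (B : ℂ) : ∃ u : ℂ, ‖u‖ = 1 ∧ u ^ 2 * B = -(‖B‖ : ℂ) := by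
  rcases eq_or_ne B 0 with rfl | hB
  · exact ⟨1, by simp⟩
  · obtain ⟨u, hu⟩ := IsAlgClosed.exists_pow_nat_eq (-(‖B‖ : ℂ) / B) two_pos
    have hB' : ‖B‖ ≠ 0 := norm_ne_zero_iff.2 hB
    refine ⟨u, ?_, by rw [hu, div_mul_cancel₀ _ hB]⟩
    have h : ‖u‖ ^ 2 = 1 := by
      rw [← norm_pow, hu, norm_div, norm_neg, Complex.norm_real, norm_norm, div_self hB']
    exact (pow_eq_one_iff_of_nonneg (norm_nonneg _) two_ne_zero).1 h

theorem IsGaussianWith.exists_hasDiagonalForm {ρ : FockSpace →L[ℂ] FockSpace} {d : Fin 2 → ℝ}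
    {V : Matrix (Fin 2) (Fin 2) ℝ} (h : IsGaussianWith ρ d V) :
    ∃ v₁ v₂ e₁ e₂ : ℝ, v₂ ≤ v₁ ∧ HasDiagonalForm ρ v₁ v₂ e₁ e₂ := by
  obtain ⟨-, hV, hχ⟩ := h
  have h10 : V 1 0 = V 0 1 := hV.apply 0 1
  -- With B = (V₁₁ - V₀₀)/2 + iV₀₁ the quadratic form at ζ is (tr V/2)‖ζ‖² + Re(Bζ²). Substituting ζ
  -- = uξ turns B into u²B, and the value -‖B‖ gives the imaginary direction the larger eigenvalue.
  obtain ⟨u, hu, huB⟩ := exists_unit_sq_mul_eq ⟨(V 1 1 - V 0 0) / 2, V 0 1⟩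
  set b := ‖(⟨(V 1 1 - V 0 0) / 2, V 0 1⟩ : ℂ)‖ with hb
  refine ⟨(V 0 0 + V 1 1) / 2 + b, (V 0 0 + V 1 1) / 2 - b, u.re * d 0 + u.im * d 1,
    u.re * d 1 - u.im * d 0, by linarith [norm_nonneg (⟨(V 1 1 - V 0 0) / 2, V 0 1⟩ : ℂ)],
    u, hu, fun ξ => ?_⟩
  rw [hχ]
  have hre := congrArg Complex.re huB
  have him := congrArg Complex.im huB
  simp only [pow_two, Complex.mul_re, Complex.mul_im, Complex.neg_re, Complex.neg_im,
    Complex.ofReal_re, Complex.ofReal_im, neg_zero] at hre him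
  have hn : u.re * u.re + u.im * u.im = 1 := by
    rw [← Complex.normSq_apply, ← Complex.sq_norm, hu, one_pow]
  congr 1
  congr 1
  · have : (![(u * ξ).im, -(u * ξ).re] ⬝ᵥ V.mulVec ![(u * ξ).im, -(u * ξ).re] : ℝ)
        = ((V 0 0 + V 1 1) / 2 + b) * ξ.im ^ 2 + ((V 0 0 + V 1 1) / 2 - b) * ξ.re ^ 2 := by
      simp only [dotProduct, Matrix.mulVec, Fin.sum_univ_two, Matrix.cons_val_zero,
        Matrix.cons_val_one, h10, Complex.mul_re, Complex.mul_im]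
      linear_combination (ξ.re ^ 2 - ξ.im ^ 2) * hre - 2 * ξ.re * ξ.im * him
        + (V 0 0 + V 1 1) / 2 * (ξ.re ^ 2 + ξ.im ^ 2) * hn
    rw [this]; push_cast; ring
  · have : (![(u * ξ).im, -(u * ξ).re] ⬝ᵥ d : ℝ)
        = ξ.im * (u.re * d 0 + u.im * d 1) - ξ.re * (u.re * d 1 - u.im * d 0) := by
      simp only [dotProduct, Fin.sum_univ_two, Matrix.cons_val_zero,
        Matrix.cons_val_one, Complex.mul_re, Complex.mul_im]
      ring
    rw [this]

theorem IsGaussianWith.hasDiagonalForm_diagonal {ρ : FockSpace →L[ℂ] FockSpace} {e₁ e₂ v₁ v₂ : ℝ}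
    (h : IsGaussianWith ρ ![e₁, e₂] (Matrix.diagonal ![v₁, v₂])) :
    HasDiagonalForm ρ v₁ v₂ e₁ e₂ := by
  refine ⟨1, norm_one, fun ξ => ?_⟩
  rw [one_mul, h.2.2]
  congr 1
  congr 1
  · simp [dotProduct, Matrix.mulVec_diagonal, Fin.sum_univ_two]; ring
  · simp [dotProduct, Fin.sum_univ_two]; ring

theorem numberExpectation_eq {ρ : FockSpace →L[ℂ] FockSpace} (hρ : IsDensityOperator ρ)
    {f : ℕ → ℝ} (hf : ∀ n, 0 ≤ f n) {g : ℝ} (h : HasSum (fun n => numberProb ρ n * f n) g) :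
    numberExpectation ρ f = ENNReal.ofReal g := by
  rw [← h.tsum_eq, ENNReal.ofReal_tsum_of_nonneg
    (fun n => mul_nonneg (numberProb_nonneg hρ n) (hf n)) h.summable, numberExpectation]
  refine tsum_congr fun n => ?_
  rw [mul_comm, ENNReal.ofReal_mul (numberProb_nonneg hρ n)]; rfl

theorem summable_of_numberExpectation_ne_top {ρ : FockSpace →L[ℂ] FockSpace}
    (hρ : IsDensityOperator ρ) {f : ℕ → ℝ} (hf : ∀ n, 0 ≤ f n)
    (h : numberExpectation ρ f ≠ ⊤) : Summable fun n => numberProb ρ n * f n := by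
  have h1 := ENNReal.summable_toReal h
  refine h1.congr fun n => ?_
  rw [ENNReal.toReal_mul, ENNReal.toReal_ofReal (hf n), mul_comm]
  congr 1
  exact ENNReal.toReal_ofReal (numberProb_nonneg hρ n)

theorem hasDerivAt_gaussGen_one (v₁ v₂ e₁ e₂ : ℝ) :
    HasDerivAt (gaussGen v₁ v₂ e₁ e₂) ((v₁ + v₂ - 2) / 4 + (e₁ ^ 2 + e₂ ^ 2) / 2) 1 := by
  have h2 : √(2 : ℝ) * √2 = 2 := Real.mul_self_sqrt zero_le_two
  have h0 : √(2 : ℝ) ≠ 0 := by positivity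
  have e (v : ℝ) : 1 + v - 1 * (v - 1) = 2 := by ring
  have d (v : ℝ) : HasDerivAt (fun z : ℝ => 1 + v - z * (v - 1)) (-(v - 1)) 1 := by
    simpa using ((hasDerivAt_id (1 : ℝ)).mul_const (v - 1)).const_sub (1 + v)
  have ds (v : ℝ) : HasDerivAt (fun z : ℝ => √(1 + v - z * (v - 1))) (-(v - 1) / (2 * √2)) 1 := by
    have := (d v).sqrt (by rw [e]; norm_num)
    rwa [e] at this
  have de (a v : ℝ) : HasDerivAt (fun z : ℝ => a ^ 2 / (1 + v - z * (v - 1)))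
      (-(a ^ 2 * -(v - 1)) / 2 ^ 2) 1 := by
    have := (hasDerivAt_const (1 : ℝ) (a ^ 2)).div (d v) (by rw [e]; norm_num)
    rw [e] at this
    exact this.congr_deriv (by ring)
  have dm : HasDerivAt (fun z : ℝ => -(1 - z)) 1 1 := by
    exact ((hasDerivAt_id (1 : ℝ)).const_sub 1).neg.congr_deriv (neg_neg 1)
  have hfin := ((hasDerivAt_const (1 : ℝ) (2 : ℝ)).div ((ds v₁).mul (ds v₂))
    (by simp only [Pi.mul_apply, e]; positivity)).mul (dm.mul ((de e₁ v₁).add (de e₂ v₂))).exp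
  refine hfin.congr_deriv ?_
  simp only [Pi.mul_apply, Pi.div_apply, Pi.add_apply, e, h2, sub_self, neg_zero, zero_mul,
    Real.exp_zero]
  field_simp
  ring

/-- The first moment of a Gaussian state. -/
theorem energy_le {ρ : FockSpace →L[ℂ] FockSpace} (hρ : IsDensityOperator ρ)
    {v₁ v₂ e₁ e₂ nbar : ℝ} (hv₁ : 0 ≤ v₁) (hv₂ : 0 ≤ v₂) (h : HasDiagonalForm ρ v₁ v₂ e₁ e₂)
    (hn : 0 ≤ nbar) (hE : numberExpectation ρ (fun n => (n : ℝ)) ≤ ENNReal.ofReal nbar) :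
    (v₁ + v₂ - 2) / 4 + (e₁ ^ 2 + e₂ ^ 2) / 2 ≤ nbar := by
  have hs := summable_of_numberExpectation_ne_top hρ (fun n => n.cast_nonneg)
    (ne_top_of_le_ne_top ENNReal.ofReal_ne_top hE)
  rw [numberExpectation_eq hρ (fun n => n.cast_nonneg) hs.hasSum, ENNReal.ofReal_le_ofReal_iff hn]
    at hE
  have hslope := (hasDerivAt_iff_tendsto_slope.1 (hasDerivAt_gaussGen_one v₁ v₂ e₁ e₂)).mono_left
    (nhdsWithin_mono 1 fun x (hx : x ∈ Set.Iio 1) => (Set.mem_Iio.1 hx).ne)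
  refine le_of_tendsto hslope ?_
  filter_upwards [Ioo_mem_nhdsLT (show (0 : ℝ) < 1 from one_pos)] with x hx
  have hx1 : x - 1 < 0 := by linarith [hx.2]
  have hg1 : gaussGen v₁ v₂ e₁ e₂ 1 = 1 := by
    have h2 : √(2 : ℝ) * √2 = 2 := Real.mul_self_sqrt zero_le_two
    have e (v : ℝ) : 1 + v - 1 * (v - 1) = 2 := by ring
    rw [gaussGen, e, e, h2]; simp
  rw [slope_def_field, hg1, div_le_iff_of_neg hx1]
  have h1 := (hasSum_numberProb hρ).add (hs.hasSum.mul_left (x - 1))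
  have h2 := hasSum_gaussGen_of_lt_one hρ hv₁ hv₂ h hx.1 hx.2
  have h3 : 1 + (x - 1) * ∑' n, numberProb ρ n * (n : ℝ) ≤ gaussGen v₁ v₂ e₁ e₂ x := by
    refine hasSum_le (fun n => ?_) h1 h2
    -- Bernoulli's inequality xⁿ ≥ 1 + n(x - 1), averaged over pₙ, bounds every left slope of G at 1
    -- by the mean photon number.
    have h4 := one_add_mul_sub_le_pow (show (-1 : ℝ) ≤ x by linarith [hx.1]) n
    nlinarith [numberProb_nonneg hρ n, mul_le_mul_of_nonneg_left h4 (numberProb_nonneg hρ n)]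
  nlinarith

/-- For v₁ > 1, v₁v₂ ≥ 1 places the zero of the second factor, if any, no closer to 0 than (v₁ +
1)/(v₁ - 1). For v₁ = 1 also v₂ = 1, and there is no zero at all. -/
theorem exists_radius {v₁ v₂ z : ℝ} (hv₂ : 0 ≤ v₂) (hv : v₂ ≤ v₁) (hvv : 1 ≤ v₁ * v₂)
    (hz : z * (v₁ - 1) < v₁ + 1) :
    ∃ r, z < r ∧ r * |v₁ - 1| ≤ v₁ + 1 ∧ r * |v₂ - 1| ≤ v₂ + 1 := by
  have hv₁ : 1 ≤ v₁ := by nlinarith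
  rcases hv₁.eq_or_lt with rfl | h1
  · obtain rfl : v₂ = 1 := by linarith
    exact ⟨z + 1, by simp⟩
  · have h0 : 0 < v₁ - 1 := by linarith
    refine ⟨(v₁ + 1) / (v₁ - 1), by rwa [lt_div_iff₀ h0], ?_, ?_⟩
    · rw [abs_of_pos h0, div_mul_cancel₀ _ h0.ne']
    · rw [div_mul_eq_mul_div, div_le_iff₀ h0]
      rcases abs_cases (v₂ - 1) with ⟨h, _⟩ | ⟨h, _⟩ <;> rw [h] <;> nlinarith

theorem numberExpectation_exp_eq {ρ : FockSpace →L[ℂ] FockSpace} (hρ : IsDensityOperator ρ)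
    {v₁ v₂ e₁ e₂ ω : ℝ} (hv₂ : 0 ≤ v₂) (hv : v₂ ≤ v₁) (hvv : 1 ≤ v₁ * v₂)
    (h : HasDiagonalForm ρ v₁ v₂ e₁ e₂) (hz : Real.exp ω * (v₁ - 1) < v₁ + 1) :
    numberExpectation ρ (fun n => Real.exp (ω * n))
      = ENNReal.ofReal (gaussGen v₁ v₂ e₁ e₂ (Real.exp ω)) := by
  obtain ⟨r, hzr, hr₁, hr₂⟩ := exists_radius hv₂ hv hvv hz
  refine numberExpectation_eq hρ (fun n => (Real.exp_pos _).le) ?_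
  have := hasSum_gaussGen hρ (hv₂.trans hv) hv₂ h hr₁ hr₂ (Real.exp_pos ω).le hzr
  refine this.congr_fun fun n => ?_
  rw [← Real.exp_nat_mul, mul_comm ω]

/-- A finite sum S at e^ω would bound G on [0, R), where R = (v₁ + 1)/(v₁ - 1) ≤ e^ω. But the
inverse square root diverges at R, and for arguments at least 1 the displacement exponential only
increases G. -/
theorem numberExpectation_exp_eq_top {ρ : FockSpace →L[ℂ] FockSpace} (hρ : IsDensityOperator ρ)
    {v₁ v₂ e₁ e₂ ω : ℝ} (hv₂ : 0 ≤ v₂) (hv : v₂ ≤ v₁) (hvv : 1 ≤ v₁ * v₂)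
    (h : HasDiagonalForm ρ v₁ v₂ e₁ e₂) (hv₁ : 1 < v₁)
    (hz : v₁ + 1 ≤ Real.exp ω * (v₁ - 1)) :
    numberExpectation ρ (fun n => Real.exp (ω * n)) = ⊤ := by
  by_contra hne
  have hs := summable_of_numberExpectation_ne_top hρ (fun n => (Real.exp_pos _).le) hne
  set S := ∑' n, numberProb ρ n * Real.exp (ω * n) with hS
  have h0 : 0 < v₁ - 1 := by linarith
  set R := (v₁ + 1) / (v₁ - 1) with hR
  have hRv : R * (v₁ - 1) = v₁ + 1 := div_mul_cancel₀ _ h0.ne'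
  have hRz : R ≤ Real.exp ω := by rwa [hR, div_le_iff₀ h0]
  have hR1 : 1 < R := by rw [hR, lt_div_iff₀ h0]; linarith
  have hr₁ : R * |v₁ - 1| ≤ v₁ + 1 := by rw [abs_of_pos h0, hRv]
  have hr₂ : R * |v₂ - 1| ≤ v₂ + 1 := by
    rw [hR, div_mul_eq_mul_div, div_le_iff₀ h0]
    rcases abs_cases (v₂ - 1) with ⟨h, _⟩ | ⟨h, _⟩ <;> rw [h] <;> nlinarith
  have hle : ∀ x, 0 ≤ x → x < R → gaussGen v₁ v₂ e₁ e₂ x ≤ S := by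
    intro x hx0 hxR
    refine hasSum_le (fun n => ?_) (hasSum_gaussGen hρ (hv₂.trans hv) hv₂ h hr₁ hr₂ hx0 hxR)
      hs.hasSum
    rw [mul_comm ω, Real.exp_nat_mul]
    have := numberProb_nonneg hρ n
    gcongr
    exact hxR.le.trans hRz
  set C := S ^ 2 * ((v₁ - 1) * (2 * (v₂ + 1))) with hC
  have hC0 : 0 ≤ C := by positivity
  -- The first entry keeps R - η ≥ 1. The second forces Cη < 1, whereas G(R - η) ≤ S would require
  -- Cη ≥ 4.
  set η := min (R - 1) (1 / (C + 1)) with hη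
  have hη0 : 0 < η := lt_min (by linarith) (by positivity)
  have hηR : η ≤ R - 1 := min_le_left _ _
  have hx := hle (R - η) (by linarith) (by linarith)
  have ht₁ : 1 + v₁ - (R - η) * (v₁ - 1) = (v₁ - 1) * η := by linear_combination (-1 : ℝ) * hRv
  have ht₂pos : 0 < 1 + v₂ - (R - η) * (v₂ - 1) := by
    have h5 : (R - η) * (v₂ - 1) ≤ (R - η) * |v₂ - 1| :=
      mul_le_mul_of_nonneg_left (le_abs_self _) (by linarith)
    rcases eq_or_lt_of_le (abs_nonneg (v₂ - 1)) with h6 | h6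
    · rw [← h6] at h5; linarith
    · nlinarith
  have ht₂ : 1 + v₂ - (R - η) * (v₂ - 1) ≤ 2 * (v₂ + 1) := by
    have h5 : -((R - η) * (v₂ - 1)) ≤ (R - η) * |v₂ - 1| := by
      rw [← mul_neg]
      exact mul_le_mul_of_nonneg_left (neg_le_abs _) (by linarith)
    nlinarith [abs_nonneg (v₂ - 1)]
  have hlow : 2 / (√((v₁ - 1) * η) * √(2 * (v₂ + 1))) ≤ S := by
    refine le_trans ?_ hx
    rw [gaussGen, ht₁]
    have hp : 0 < √((v₁ - 1) * η) := Real.sqrt_pos.2 (by positivity)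
    have hp2 : 0 < √(1 + v₂ - (R - η) * (v₂ - 1)) := Real.sqrt_pos.2 ht₂pos
    have hexp : 1 ≤ Real.exp (-(1 - (R - η)) * (e₁ ^ 2 / ((v₁ - 1) * η)
        + e₂ ^ 2 / (1 + v₂ - (R - η) * (v₂ - 1)))) := by
      refine Real.one_le_exp (mul_nonneg (by linarith) ?_)
      positivity
    refine le_trans ?_ (le_mul_of_one_le_right (by positivity) hexp)
    gcongr
  rw [← Real.sqrt_mul (by positivity), div_le_iff₀ (Real.sqrt_pos.2 (by positivity))] at hlow
  have hsq := pow_le_pow_left₀ two_pos.le hlow 2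
  rw [mul_pow, Real.sq_sqrt (by positivity)] at hsq
  have hCη : C * η < 1 := by
    refine (mul_le_mul_of_nonneg_left (min_le_right _ _) hC0).trans_lt ?_
    rw [mul_one_div, div_lt_one (by positivity)]; linarith
  have : S ^ 2 * ((v₁ - 1) * η * (2 * (v₂ + 1))) = C * η := by rw [hC]; ring
  linarith

/-! ### The closed form in terms of coth(ω/2) -/

theorem coth_half {ω : ℝ} (hω : 0 < ω) :
    Real.cosh (ω / 2) / Real.sinh (ω / 2) = (Real.exp ω + 1) / (Real.exp ω - 1) := by
  have h1 : 0 < Real.exp ω - 1 := by linarith [Real.one_lt_exp_iff.2 hω]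
  have h2 : 0 < Real.sinh (ω / 2) := Real.sinh_pos_iff.2 (by linarith)
  rw [div_eq_div_iff h2.ne' h1.ne', Real.cosh_eq, Real.sinh_eq]
  have h3 : Real.exp ω = Real.exp (ω / 2) * Real.exp (ω / 2) := by
    rw [← Real.exp_add]; congr 1; ring
  have h4 : Real.exp (ω / 2) * Real.exp (-(ω / 2)) = 1 := by rw [← Real.exp_add]; simp
  rw [h3]
  linear_combination Real.exp (ω / 2) * h4

/-- `2 / ω ≤ coth (ω / 2)` without denominators. -/
theorem two_mul_exp_sub_one_le {ω : ℝ} (hω : 0 ≤ ω) :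
    2 * (Real.exp ω - 1) ≤ ω * (Real.exp ω + 1) := by
  have hd (x : ℝ) : HasDerivAt (fun x => x * (Real.exp x + 1) - 2 * (Real.exp x - 1))
      (1 * (Real.exp x + 1) + x * Real.exp x - 2 * Real.exp x) x :=
    ((hasDerivAt_id x).mul ((Real.hasDerivAt_exp x).add_const 1)).sub
      (((Real.hasDerivAt_exp x).sub_const 1).const_mul 2)
  have hm : MonotoneOn (fun x => x * (Real.exp x + 1) - 2 * (Real.exp x - 1)) (Set.Ici 0) := by
    refine monotoneOn_of_deriv_nonneg (convex_Ici 0)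
      (fun x _ => (hd x).continuousAt.continuousWithinAt)
      (fun x _ => (hd x).differentiableAt.differentiableWithinAt) fun x _ => ?_
    rw [(hd x).deriv]
    have h1 := mul_le_mul_of_nonneg_left (Real.add_one_le_exp (-x)) (Real.exp_pos x).le
    rw [← Real.exp_add, add_neg_cancel, Real.exp_zero] at h1
    linarith
  have := hm (Set.mem_Ici.2 le_rfl) (Set.mem_Ici.2 hω) hω
  simp at this
  linarith

theorem gaussGen_exp_eq {ω m r a b : ℝ} (hω : 0 < ω) (h₁ : 0 < kappaSq ω m r)
    (h₂ : 0 < kappaSq ω m (-r)) :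
    gaussGen (Real.exp (2 * r) * (2 * m + 1)) (Real.exp (-2 * r) * (2 * m + 1)) (√2 * a) (√2 * b)
        (Real.exp ω)
      = 2 * Real.exp (2 * a ^ 2 / kappa ω m r ^ 2 + 2 * b ^ 2 / kappa ω m (-r) ^ 2)
          / ((Real.exp ω - 1) * kappa ω m r * kappa ω m (-r)) := by
  have hz : 0 < Real.exp ω - 1 := by linarith [Real.one_lt_exp_iff.2 hω]
  -- At z = e^ω each factor is (e^ω - 1)κ², since coth(ω/2) = (e^ω + 1)/(e^ω - 1).
  have ht (s : ℝ) : 1 + Real.exp (2 * s) * (2 * m + 1)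
      - Real.exp ω * (Real.exp (2 * s) * (2 * m + 1) - 1) = (Real.exp ω - 1) * kappaSq ω m s := by
    rw [kappaSq, coth_half hω]; field_simp; ring
  have h2 : √(2 : ℝ) ^ 2 = 2 := Real.sq_sqrt zero_le_two
  rw [gaussGen, show -2 * r = 2 * -r by ring, ht, ht, Real.sqrt_mul hz.le, Real.sqrt_mul hz.le,
    kappa, kappa, Real.sq_sqrt h₁.le, Real.sq_sqrt h₂.le, mul_pow, mul_pow, h2,
    mul_mul_mul_comm, Real.mul_self_sqrt hz.le, div_mul_eq_mul_div, mul_assoc (Real.exp ω - 1)]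
  congr 3
  field_simp
  ring

theorem gaussian_numberExpectation {ρ : FockSpace →L[ℂ] FockSpace} {α : ℂ} {m r ω : ℝ}
    (hm : 0 ≤ m) (hr : 0 ≤ r) (hω : 0 < ω)
    (h : IsGaussianWith ρ ![√2 * α.re, √2 * α.im]
      (Matrix.diagonal ![Real.exp (2 * r) * (2 * m + 1), Real.exp (-2 * r) * (2 * m + 1)])) :
    (0 < kappaSq ω m r →
        0 < kappaSq ω m (-r) ∧
        numberExpectation ρ (fun n => Real.exp (ω * n)) =
          ENNReal.ofReal
            (2 * Real.exp (2 * α.re ^ 2 / kappa ω m r ^ 2 + 2 * α.im ^ 2 / kappa ω m (-r) ^ 2)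
              / ((Real.exp ω - 1) * kappa ω m r * kappa ω m (-r)))) ∧
      (kappaSq ω m r ≤ 0 → numberExpectation ρ (fun n => Real.exp (ω * n)) = ⊤) := by
  have hdiag := h.hasDiagonalForm_diagonal
  have hρ := h.1
  have hz : 0 < Real.exp ω - 1 := by linarith [Real.one_lt_exp_iff.2 hω]
  have hexp : Real.exp (-2 * r) ≤ Real.exp (2 * r) := Real.exp_le_exp.2 (by linarith)
  have hv : Real.exp (-2 * r) * (2 * m + 1) ≤ Real.exp (2 * r) * (2 * m + 1) := by gcongr
  have hv₂ : 0 ≤ Real.exp (-2 * r) * (2 * m + 1) := by positivity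
  have hvv := one_le_mul_of_hasDiagonalForm hρ hdiag hv
  have hk : kappaSq ω m r = (Real.exp ω + 1) / (Real.exp ω - 1)
      - Real.exp (2 * r) * (2 * m + 1) := by
    rw [kappaSq, coth_half hω]; ring
  have hk' : kappaSq ω m (-r) = (Real.exp ω + 1) / (Real.exp ω - 1)
      - Real.exp (-2 * r) * (2 * m + 1) := by
    rw [kappaSq, coth_half hω, show 2 * -r = -2 * r by ring]; ring
  refine ⟨fun hpos => ?_, fun hneg => ?_⟩
  · have hpos' : 0 < kappaSq ω m (-r) := by rw [hk'] ; rw [hk] at hpos; linarith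
    refine ⟨hpos', ?_⟩
    rw [← gaussGen_exp_eq hω hpos hpos']
    refine numberExpectation_exp_eq hρ hv₂ hv hvv hdiag ?_
    rw [hk, sub_pos, lt_div_iff₀ hz] at hpos
    linarith
  · rw [hk, sub_nonpos, div_le_iff₀ hz] at hneg
    refine numberExpectation_exp_eq_top hρ hv₂ hv hvv hdiag ?_ (by linarith)
    nlinarith

/-! ### Energy-bounded Gaussian states and their mixtures -/

/-- The largest eigenvalue of the covariance matrix of an energy-bounded Gaussian state. -/
theorem eigenvalue_le {v₁ v₂ n : ℝ} (hn : 0 ≤ n) (hv₁ : 0 ≤ v₁) (hvv : 1 ≤ v₁ * v₂)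
    (hsum : v₁ + v₂ ≤ 2 + 4 * n) : v₁ ≤ 3 / 2 + 2 * n * (2 + n) := by
  by_contra! hlt
  have h1 : v₁ * (v₁ + v₂) ≤ v₁ * (2 + 4 * n) := mul_le_mul_of_nonneg_left hsum hv₁
  have h2 : 0 < (v₁ - (3 / 2 + 2 * n * (2 + n))) * (v₁ + (3 / 2 + 2 * n * (2 + n)) - (2 + 4 * n)) :=
    mul_pos (by linarith) (by nlinarith)
  -- The hypotheses give f(v₁) ≤ 0 for f(x) = x² - (2 + 4n)x + 1. At the claimed bound f equals (2n²
  -- + 2n - 1/2)² ≥ 0, and by `h2` it is larger still at v₁.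
  nlinarith [sq_nonneg (2 * n ^ 2 + 2 * n - 1 / 2)]

theorem numberExpectation_exp_le {ρ : FockSpace →L[ℂ] FockSpace} {nbar ε Ω ω : ℝ}
    (hn : 0 < nbar) (hε : 0 < ε) (hε1 : ε < 1) (hΩ : 0 < Ω) (hω : 0 < ω)
    (hω₁ : ω ≤ 2 * ε / (3 / 2 + 2 * nbar * (2 + nbar)))
    (hω₂ : ω ≤ (1 - ε) / nbar * Real.log ((1 - ε) * Ω)) (hρ : ρ ∈ boundedGaussians nbar) :
    numberExpectation ρ (fun n => Real.exp (ω * n)) ≤ ENNReal.ofReal Ω := by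
  obtain ⟨⟨d, V, hG⟩, hE⟩ := hρ
  obtain ⟨v₁, v₂, e₁, e₂, hv, hdiag⟩ := hG.exists_hasDiagonalForm
  have hD := hG.1
  obtain ⟨hv₁, hv₂⟩ := hdiag.nonneg hD
  have hvv := one_le_mul_of_hasDiagonalForm hD hdiag hv
  have hen := energy_le hD hv₁ hv₂ hdiag hn.le hE
  have hv₁B := eigenvalue_le hn.le hv₁ hvv (by nlinarith [sq_nonneg e₁, sq_nonneg e₂])
  have hB : 0 < 3 / 2 + 2 * nbar * (2 + nbar) := by positivity
  have hωv : ω * v₁ ≤ 2 * ε := by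
    rw [le_div_iff₀ hB] at hω₁
    exact (mul_le_mul_of_nonneg_left hv₁B hω.le).trans hω₁
  set z := Real.exp ω with hz
  have hz1 : 1 < z := Real.one_lt_exp_iff.2 hω
  have hcoth : 2 * (z - 1) ≤ ω * (z + 1) := two_mul_exp_sub_one_le hω.le
  have h1ε : 0 < 1 - ε := by linarith
  have hsum : 2 ≤ v₁ + v₂ := by nlinarith [sq_nonneg (v₁ - v₂)]
  -- Combining ωv₁ ≤ 2ε with 2/ω ≤ coth(ω/2) gives v₁ ≤ ε coth(ω/2), so both factors are at least (z
  -- + 1)(1 - ε).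
  have hvz : v₁ * (z - 1) ≤ ε * (z + 1) := by
    have h1 := mul_le_mul_of_nonneg_left hcoth hv₁
    have h2 := mul_le_mul_of_nonneg_right hωv (by linarith : 0 ≤ z + 1)
    linarith
  have hvz₂ : v₂ * (z - 1) ≤ v₁ * (z - 1) := mul_le_mul_of_nonneg_right hv (by linarith)
  have ht : (z + 1) * (1 - ε) ≤ 1 + v₁ - z * (v₁ - 1) := by linarith
  have ht' : (z + 1) * (1 - ε) ≤ 1 + v₂ - z * (v₂ - 1) := by linarith
  rw [numberExpectation_exp_eq hD hv₂ hv hvv hdiag (by nlinarith)]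
  refine ENNReal.ofReal_le_ofReal ?_
  have hm0 : 0 < (z + 1) * (1 - ε) := by positivity
  rw [gaussGen]
  have hS : e₁ ^ 2 / (1 + v₁ - z * (v₁ - 1)) + e₂ ^ 2 / (1 + v₂ - z * (v₂ - 1))
      ≤ (e₁ ^ 2 + e₂ ^ 2) / ((z + 1) * (1 - ε)) := by
    rw [add_div]; gcongr
  have hlog : ω * nbar / (1 - ε) ≤ Real.log ((1 - ε) * Ω) := by
    rw [div_mul_eq_mul_div, le_div_iff₀ hn] at hω₂
    rw [div_le_iff₀ h1ε]; linarith
  have hexp : -(1 - z) * (e₁ ^ 2 / (1 + v₁ - z * (v₁ - 1)) + e₂ ^ 2 / (1 + v₂ - z * (v₂ - 1)))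
      ≤ ω * nbar / (1 - ε) := by
    refine (mul_le_mul_of_nonneg_left hS (by linarith)).trans ?_
    -- Since v₁ + v₂ ≥ 2, the covariance contributes nonnegatively to the energy, leaving at most
    -- 2`nbar` for the displacement.
    have he : e₁ ^ 2 + e₂ ^ 2 ≤ 2 * nbar := by linarith
    rw [mul_div_assoc', div_le_div_iff₀ hm0 h1ε]
    have h1 : (z - 1) * (e₁ ^ 2 + e₂ ^ 2) ≤ (z - 1) * (2 * nbar) :=
      mul_le_mul_of_nonneg_left he (by linarith)
    have h2 := mul_le_mul_of_nonneg_right hcoth hn.le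
    have h3 : (z - 1) * (e₁ ^ 2 + e₂ ^ 2) ≤ ω * nbar * (z + 1) := by linarith
    have h4 := mul_le_mul_of_nonneg_right h3 h1ε.le
    linarith
  have hpre : 2 / (√(1 + v₁ - z * (v₁ - 1)) * √(1 + v₂ - z * (v₂ - 1))) ≤ 1 / (1 - ε) := by
    have h2 : 2 * (1 - ε) ≤ (z + 1) * (1 - ε) := by nlinarith
    have h3 : √((z + 1) * (1 - ε)) * √((z + 1) * (1 - ε))
        ≤ √(1 + v₁ - z * (v₁ - 1)) * √(1 + v₂ - z * (v₂ - 1)) := by gcongr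
    rw [Real.mul_self_sqrt hm0.le] at h3
    rw [div_le_div_iff₀ (hm0.trans_le h3) h1ε]
    linarith
  calc _ ≤ 1 / (1 - ε) * ((1 - ε) * Ω) := by
        refine mul_le_mul hpre ?_ (Real.exp_pos _).le (by positivity)
        rw [← Real.exp_log (mul_pos h1ε hΩ)]
        exact Real.exp_le_exp.2 (hexp.trans hlog)
    _ = Ω := by field_simp

/-- Subadditivity suffices: on operators that need not be positive, `ENNReal.ofReal` truncates
negative diagonal entries and is not additive. -/
theorem convex_numberExpectation_le (f : ℕ → ℝ) (c : ENNReal) :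
    Convex ℝ {ρ : FockSpace →L[ℂ] FockSpace | numberExpectation ρ f ≤ c} := by
  intro ρ hρ σ hσ a b ha hb hab
  have hle : numberExpectation (a • ρ + b • σ) f
      ≤ ENNReal.ofReal a * numberExpectation ρ f + ENNReal.ofReal b * numberExpectation σ f := by
    rw [numberExpectation, numberExpectation, numberExpectation, ← ENNReal.tsum_mul_left,
      ← ENNReal.tsum_mul_left, ← ENNReal.tsum_add]
    refine ENNReal.tsum_le_tsum fun n => ?_
    have h : (inner ℂ (fock n) ((a • ρ + b • σ) (fock n))).re
        = a * (inner ℂ (fock n) (ρ (fock n))).re + b * (inner ℂ (fock n) (σ (fock n))).re := by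
      simp [inner_fock]
    rw [h]
    refine (mul_le_mul_right ENNReal.ofReal_add_le _).trans_eq ?_
    rw [ENNReal.ofReal_mul ha, ENNReal.ofReal_mul hb]
    ring
  refine hle.trans ?_
  calc _ ≤ ENNReal.ofReal a * c + ENNReal.ofReal b * c :=
        add_le_add (mul_le_mul_right hρ _) (mul_le_mul_right hσ _)
    _ = c := by rw [← add_mul, ← ENNReal.ofReal_add ha hb, hab, ENNReal.ofReal_one, one_mul]

end Bosonic

end

theorem mainTheorem3 :
    -- closed form of `⟨e^{ω n̂}⟩`, finite exactly when `κ₊² > 0`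
    (∀ (ρ : Bosonic.FockSpace →L[ℂ] Bosonic.FockSpace) (α : ℂ) (m r ω : ℝ),
      0 ≤ m → 0 ≤ r → 0 < ω →
      Bosonic.IsGaussianWith ρ ![√2 * α.re, √2 * α.im]
        (Matrix.diagonal ![Real.exp (2 * r) * (2 * m + 1), Real.exp (-2 * r) * (2 * m + 1)]) →
      (0 < Bosonic.kappaSq ω m r →
        0 < Bosonic.kappaSq ω m (-r) ∧
        Bosonic.numberExpectation ρ (fun n => Real.exp (ω * n)) =
          ENNReal.ofReal
            (2 * Real.exp (2 * α.re ^ 2 / Bosonic.kappa ω m r ^ 2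
                + 2 * α.im ^ 2 / Bosonic.kappa ω m (-r) ^ 2)
              / ((Real.exp ω - 1) * Bosonic.kappa ω m r * Bosonic.kappa ω m (-r)))) ∧
      (Bosonic.kappaSq ω m r ≤ 0 →
        Bosonic.numberExpectation ρ (fun n => Real.exp (ω * n)) = ⊤)) ∧
    -- the exponential cut-off for energy-bounded Gaussian states and their mixtures
    (∀ (nbar ε Ω ω : ℝ), 0 < nbar → 0 < ε → ε < 1 → 1 / (1 - ε) < Ω →
      ω = min (2 * ε / (3 / 2 + 2 * nbar * (2 + nbar)))
        ((1 - ε) / nbar * Real.log ((1 - ε) * Ω)) →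
      0 < ω ∧
      (∀ ρ ∈ Bosonic.boundedGaussians nbar,
        Bosonic.numberExpectation ρ (fun n => Real.exp (ω * n)) ≤ ENNReal.ofReal Ω) ∧
      (∀ ρ ∈ convexHull ℝ (Bosonic.boundedGaussians nbar),
        Bosonic.numberExpectation ρ (fun n => Real.exp (ω * n)) ≤ ENNReal.ofReal Ω)) := by
  refine ⟨fun ρ α m r ω hm hr hω h => Bosonic.gaussian_numberExpectation hm hr hω h,
    fun nbar ε Ω ω hn hε hε1 hΩ hω => ?_⟩
  have h1ε : 0 < 1 - ε := by linarith
  have hΩ0 : 0 < Ω := (one_div_pos.2 h1ε).trans hΩ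
  have hω0 : 0 < ω := by
    have hlog : 0 < Real.log ((1 - ε) * Ω) := by
      refine Real.log_pos ?_
      rwa [div_lt_iff₀ h1ε, mul_comm] at hΩ
    rw [hω]
    exact lt_min (by positivity) (by positivity)
  have hle := fun ρ hρ => Bosonic.numberExpectation_exp_le (ρ := ρ) hn hε hε1 hΩ0 hω0
    (hω.trans_le (min_le_left _ _)) (hω.trans_le (min_le_right _ _)) hρ
  exact ⟨hω0, hle, fun ρ hρ =>
    convexHull_min hle (Bosonic.convex_numberExpectation_le _ _) hρ⟩
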